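/- Let $P_1,P_2\ge 0$, $N>0$ and $0\le a<1$. Consider the Gaussian Z-interference channel with weak interference, $$Y_1=X_1+Z,\qquad Y_2=X_2+\sqrt{a}\,X_1+Z,$$ used with block length $n$, where $Z\in\mathbb{R}^n$ is a Gaussian vector with i.i.d. coordinates of mean $0$ and variance $N$. A code of block length $n$ consists of message set sizes $M_1,M_2\ge 1$, encoding functions $W_i\mapsto X_i\in\mathbb{R}^n$ with $\|X_i\|^2\le nP_i$ for every message, and (measurable) decoding functions $Y_i\mapsto\widehat W_i$; the messages $W_1,W_2$ are uniformly distributed over their sets, and $W_1,W_2,Z$ are independent. The rates are $R_i=\frac1n\log M_i$ (natural logarithm). A sequence of codes, one for each block length $n$, is called reliable if $\mathbb{P}\{\widehat W_1\ne W_1\}\to 0$ and $\mathbb{P}\{\widehat W_2\ne W_2\}\to 0$ as $n\to\infty$. The capacity region is the set of all limit points of the sequences $(R_1,R_2)$ of rate pairs of reliable sequences of codes. Put $C_1=\frac12\log(1+P_1/N)$. For real sequences write $A_n\lesssim B_n$ if $A_n\le B_n+n\,\epsilon(n)$ for all $n\ge1$, for some positive function $\epsilon(n)$ tending to $0$ as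 $n\to\infty$. The pair $(C_1,C_2')$ is called the first corner point if it belongs to the capacity region and if every reliable sequence of codes satisfies $$nC_1\lesssim nR_1\ \Longrightarrow\ nR_2\lesssim nC_2'.$$ Then, for a real number $C_2'$, the pair $(C_1,C_2')$ is the first corner point if and only if $$C_2'=\frac12\log\Bigl(1+\frac{P_2}{aP_1+N}\Bigr).$$ -/

import Mathlib

open Filter Topology MeasureTheory ProbabilityTheory

/-- `A` is almost less than `B`: `A n ≤ B n + n ε(n)` for some positive `ε(n)` that tends to `0`. -/
def AlmostLE (A B : ℕ → ℝ) : Prop :=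
  ∃ ε : ℕ → ℝ, (∀ n, 0 < ε n) ∧ Tendsto ε atTop (𝓝 0) ∧
    ∀ n : ℕ, 0 < n → A n ≤ B n + n * ε n

/-- A code of block length `n` for two senders with powers `P₁`, `P₂`: message set sizes, encoders
satisfying the power constraints `‖x‖² ≤ n Pᵢ` (Euclidean norm), and decoders. -/
structure InterferenceCode (P₁ P₂ : ℝ) (n : ℕ) where
  M₁ : ℕ
  M₂ : ℕ
  M₁_pos : 0 < M₁
  M₂_pos : 0 < M₂
  enc₁ : Fin M₁ → Fin n → ℝ
  enc₂ : Fin M₂ → Fin n → ℝ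
  power₁ : ∀ w, ∑ i, enc₁ w i ^ 2 ≤ n * P₁
  power₂ : ∀ w, ∑ i, enc₂ w i ^ 2 ≤ n * P₂
  dec₁ : (Fin n → ℝ) → Fin M₁
  dec₂ : (Fin n → ℝ) → Fin M₂
  measurable_dec₁ : Measurable dec₁
  measurable_dec₂ : Measurable dec₂

namespace InterferenceCode

variable {P₁ P₂ : ℝ} {n : ℕ}

/-- The rate `R₁` in nats per channel use, so that `M₁ = exp (n R₁)` when `0 < n`. -/
noncomputable def rate₁ (c : InterferenceCode P₁ P₂ n) : ℝ := Real.log c.M₁ / n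

/-- The rate `R₂` in nats per channel use, so that `M₂ = exp (n R₂)` when `0 < n`. -/
noncomputable def rate₂ (c : InterferenceCode P₁ P₂ n) : ℝ := Real.log c.M₂ / n

/-- The joint law of `(W₁, W₂, Z)`: independent uniform messages, and independently of them a
Gaussian noise vector with i.i.d. centered coordinates of variance `N`. -/
noncomputable def law (c : InterferenceCode P₁ P₂ n) (N : ℝ) :
    Measure (Fin c.M₁ × Fin c.M₂ × (Fin n → ℝ)) :=
  (uniformOn (Set.univ : Set (Fin c.M₁))).prod
    ((uniformOn (Set.univ : Set (Fin c.M₂))).prod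
      (Measure.pi fun _ : Fin n => gaussianReal 0 N.toNNReal))

/-- The probability that decoder 1 errs when it receives `Y₁ = X₁ + Z`. -/
noncomputable def error₁ (c : InterferenceCode P₁ P₂ n) (N : ℝ) : ℝ :=
  (c.law N).real {ω | c.dec₁ (c.enc₁ ω.1 + ω.2.2) ≠ ω.1}

/-- The probability that decoder 2 errs when it receives `Y₂ = X₂ + √a X₁ + Z`. -/
noncomputable def error₂ (c : InterferenceCode P₁ P₂ n) (a N : ℝ) : ℝ :=
  (c.law N).real
    {ω | c.dec₂ (c.enc₂ ω.2.1 + Real.sqrt a • c.enc₁ ω.1 + ω.2.2) ≠ ω.2.1}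

end InterferenceCode

/-- A sequence of codes, one for each block length, whose two error probabilities over the Gaussian
Z-interference channel tend to `0`. -/
def IsReliable (a N : ℝ) {P₁ P₂ : ℝ} (c : ∀ n, InterferenceCode P₁ P₂ n) : Prop :=
  Tendsto (fun n => (c n).error₁ N) atTop (𝓝 0) ∧
    Tendsto (fun n => (c n).error₂ a N) atTop (𝓝 0)

/-- The capacity region of the Gaussian Z-interference channel: all limit points of the sequences
of rate pairs of reliable sequences of codes. -/
def capacityRegion (a N P₁ P₂ : ℝ) : Set (ℝ × ℝ) :=
  {r | ∃ c : ∀ n, InterferenceCode P₁ P₂ n, IsReliable a N c ∧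
    MapClusterPt r atTop (fun n => ((c n).rate₁, (c n).rate₂))}

/-- The capacity `(1/2) log (1 + P / N)` of the Gaussian channel without interference. -/
noncomputable def gaussianCapacity (P N : ℝ) : ℝ := 1 / 2 * Real.log (1 + P / N)

/-- `(C₁, C₂')` is the first corner point: it is achievable, and every reliable sequence of codes
with `n R₁` almost greater than `n C₁` has `n R₂` almost less than `n C₂'`. -/
def IsFirstCornerPoint (a N P₁ P₂ : ℝ) (p : ℝ × ℝ) : Prop :=
  p.1 = gaussianCapacity P₁ N ∧ p ∈ capacityRegion a N P₁ P₂ ∧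
    ∀ c : ∀ n, InterferenceCode P₁ P₂ n, IsReliable a N c →
      AlmostLE (fun n => n * p.1) (fun n => n * (c n).rate₁) →
      AlmostLE (fun n => n * (c n).rate₂) (fun n => n * p.2)

/-! Converse. Let S = √a X₁ + Z, let s = aP₁ + N, write C₂ for the claimed value, and let D be the
relative entropy of the law of S with respect to N(0, sI). Since a < 1, S has the law of √a Y₁ +
√(1-a) Z' with Z' a fresh copy of the noise, and the same map carries N(0, (P₁+N)I) to N(0, sI).
Data processing together with Fano's inequality at receiver 1 bounds log M₁ + D by nC₁, up to error
terms and unused power (`log_mul_add_integral_gaussMixLLR_le`): a first user near capacity forces S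
to look Gaussian. At receiver 2, Fano's inequality compares x₂ + S with a Gaussian vector; passing
through N(0, sI) costs D plus a term that depends on second moments only, so log M₂ is at most about
nC₂ + D (`log_mul_le_integral_gaussMixLLR`). On adding the two bounds D cancels, and the loss of
user 1 with respect to C₁ bounds the excess of user 2 over C₂ (`one_sub_error₂_mul_log_le`).

Both bounds are instances of one inequality, ∫ φ dP ≤ D(P‖Q) + ∫ exp φ dQ - 1, with φ equal to log M
on the event of correct decoding plus a log-density.

Achievability. Gaussian codebooks of slightly reduced power and threshold decoding reach (C₁, C₂):
averaged over the first codebook, the interference is Gaussian noise, so receiver 2 faces noise of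
variance close to s (`exists_interferenceCode`, `eventually_exists_interferenceCode`).

Uniqueness. A limit point is only seen along a subsequence, while the corner condition concerns
whole sequences; filling the gaps with the codes built above reconciles the two
(`le_of_mem_capacityRegion`). -/

/-! ### Densities and images of product measures. -/

section ProductMeasures

variable {ι : Type*} [Fintype ι] {α : ι → Type*} [∀ i, MeasurableSpace (α i)]

theorem lintegral_pi_prod_eq_prod_lintegral (μ : ∀ i, Measure (α i))
    [∀ i, IsProbabilityMeasure (μ i)] {f : ∀ i, α i → ENNReal} (hf : ∀ i, Measurable (f i)) :
    ∫⁻ x, ∏ i, f i (x i) ∂Measure.pi μ = ∏ i, ∫⁻ y, f i y ∂μ i := by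
  refine (lintegral_prod_eq_prod_lintegral_of_indepFun Finset.univ
    (fun i (x : ∀ i, α i) => f i (x i)) (iIndepFun_pi fun i => (hf i).aemeasurable)
    fun i => (hf i).comp (measurable_pi_apply i)).trans ?_
  refine Finset.prod_congr rfl fun i _ => ?_
  rw [← (measurePreserving_eval μ i).lintegral_comp (hf i)]

/-- It suffices to test on boxes, where the indicator is itself a product over the coordinates. -/
theorem pi_withDensity (μ : ∀ i, Measure (α i)) [∀ i, IsProbabilityMeasure (μ i)]
    {f : ∀ i, α i → ENNReal} (hf : ∀ i, Measurable (f i))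
    [∀ i, SigmaFinite ((μ i).withDensity (f i))] :
    Measure.pi (fun i => (μ i).withDensity (f i)) =
      (Measure.pi μ).withDensity fun x => ∏ i, f i (x i) := by
  refine Measure.pi_eq fun s hs => ?_
  rw [withDensity_apply _ (.univ_pi hs), ← lintegral_indicator (.univ_pi hs)]
  simp_rw [withDensity_apply _ (hs _), ← lintegral_indicator (hs _)]
  rw [← lintegral_pi_prod_eq_prod_lintegral μ fun i => (hf i).indicator (hs i)]
  congr with x
  by_cases hx : x ∈ Set.univ.pi s
  · rw [Set.indicator_of_mem hx]
    exact Finset.prod_congr rfl fun i _ => (Set.indicator_of_mem (hx i trivial) _).symm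
  · rw [Set.indicator_of_notMem hx]
    obtain ⟨i, hi⟩ : ∃ i, x i ∉ s i := by simpa using hx
    exact (Finset.prod_eq_zero (Finset.mem_univ i) (Set.indicator_of_notMem hi _)).symm

theorem map_prod_pi {β γ δ : Type*} [MeasurableSpace β] [MeasurableSpace γ] [MeasurableSpace δ]
    (μ : ι → Measure β) (ν : ι → Measure γ) [∀ i, IsProbabilityMeasure (μ i)]
    [∀ i, IsProbabilityMeasure (ν i)] {f : β × γ → δ} (hf : Measurable f) :
    ((Measure.pi μ).prod (Measure.pi ν)).map (fun p i => f (p.1 i, p.2 i)) =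
      Measure.pi fun i => ((μ i).prod (ν i)).map f := by
  have : ∀ i, IsProbabilityMeasure (((μ i).prod (ν i)).map f) := fun i =>
    Measure.isProbabilityMeasure_map hf.aemeasurable
  rw [← Measure.pi_map_pi fun i => hf.aemeasurable,
    ← (measurePreserving_arrowProdEquivProdArrow β γ ι μ ν).map_eq, Measure.map_map]
  · rfl
  · exact measurable_pi_lambda _ fun i => hf.comp (by fun_prop)
  · exact MeasurableEquiv.measurable _

end ProductMeasures

/-! ### Gaussian vectors: densities, linear combinations, second moments. -/

/-- The logarithm of the density of `gaussianReal x v` with respect to `gaussianReal x' v'`. -/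
noncomputable def gaussianLLR (x v x' v' y : ℝ) : ℝ :=
  (Real.log v' - Real.log v) / 2 - (y - x) ^ 2 / (2 * v) + (y - x') ^ 2 / (2 * v')

theorem measurable_gaussianLLR (x v x' v' : ℝ) : Measurable (gaussianLLR x v x' v') := by
  unfold gaussianLLR; fun_prop

theorem gaussianPDFReal_eq_exp {x v : ℝ} (hv : 0 < v) (y : ℝ) :
    gaussianPDFReal x v.toNNReal y =
      Real.exp (-(Real.log (2 * Real.pi * v)) / 2 - (y - x) ^ 2 / (2 * v)) := by
  have h2 : 0 < 2 * Real.pi * v := by positivity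
  rw [gaussianPDFReal, Real.coe_toNNReal _ hv.le, sub_eq_add_neg (_ / _), Real.exp_add,
    neg_div 2 (Real.log _), Real.exp_neg (_ / 2), ← Real.log_sqrt h2.le,
    Real.exp_log (Real.sqrt_pos.2 h2), neg_div]

theorem gaussianReal_eq_withDensity {v v' : ℝ} (hv : 0 < v) (hv' : 0 < v') (x x' : ℝ) :
    gaussianReal x v.toNNReal = (gaussianReal x' v'.toNNReal).withDensity
      fun y => ENNReal.ofReal (Real.exp (gaussianLLR x v x' v' y)) := by
  have hm : Measurable fun y => ENNReal.ofReal (Real.exp (gaussianLLR x v x' v' y)) :=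
    (measurable_gaussianLLR x v x' v').exp.ennreal_ofReal
  rw [gaussianReal_of_var_ne_zero _ (by simpa using hv),
    gaussianReal_of_var_ne_zero _ (by simpa using hv'),
    ← withDensity_mul _ (measurable_gaussianPDF _ _) hm]
  congr with y
  rw [Pi.mul_apply, gaussianPDF, gaussianPDF, ← ENNReal.ofReal_mul (gaussianPDFReal_nonneg _ _ _),
    gaussianPDFReal_eq_exp hv, gaussianPDFReal_eq_exp hv', ← Real.exp_add]
  have hpi : 2 * Real.pi ≠ 0 := by positivity
  rw [Real.log_mul hpi hv.ne', Real.log_mul hpi hv'.ne', gaussianLLR]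
  congr 2
  ring

theorem map_prod_gaussianReal {v v' : ℝ} (hv : 0 ≤ v) (hv' : 0 ≤ v') (x x' b c : ℝ) :
    ((gaussianReal x v.toNNReal).prod (gaussianReal x' v'.toNNReal)).map
      (fun p => b * p.1 + c * p.2) =
      gaussianReal (b * x + c * x') (b ^ 2 * v + c ^ 2 * v').toNNReal := by
  have h : (fun p : ℝ × ℝ => b * p.1 + c * p.2) =
      (fun p : ℝ × ℝ => p.1 + p.2) ∘ Prod.map (fun y => b * y) (fun y => c * y) := rfl
  rw [h, ← Measure.map_map (by fun_prop) (by fun_prop),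
    ← Measure.map_prod_map _ _ (by fun_prop) (by fun_prop), gaussianReal_map_const_mul,
    gaussianReal_map_const_mul]
  change _ ∗ _ = _
  rw [gaussianReal_conv_gaussianReal]
  congr 1
  ext
  have : 0 ≤ b ^ 2 * v + c ^ 2 * v' := by positivity
  simp [Real.coe_toNNReal _ hv, Real.coe_toNNReal _ hv', Real.coe_toNNReal _ this]

/-- The Gaussian vector with mean `x` and i.i.d. fluctuations of variance `v`. -/
noncomputable def gaussVec {n : ℕ} (x : Fin n → ℝ) (v : ℝ) : Measure (Fin n → ℝ) :=
  Measure.pi fun i => gaussianReal (x i) v.toNNReal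

section GaussVec

variable {n : ℕ}

instance (x : Fin n → ℝ) (v : ℝ) : IsProbabilityMeasure (gaussVec x v) := by
  unfold gaussVec; infer_instance

/-- The logarithm of the density of `gaussVec x v` with respect to `gaussVec x' v'`. -/
noncomputable def gaussVecLLR (x : Fin n → ℝ) (v : ℝ) (x' : Fin n → ℝ) (v' : ℝ) (y : Fin n → ℝ) :
    ℝ :=
  ∑ i, gaussianLLR (x i) v (x' i) v' (y i)

theorem gaussVecLLR_eq (x : Fin n → ℝ) (v : ℝ) (x' : Fin n → ℝ) (v' : ℝ) (y : Fin n → ℝ) :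
    gaussVecLLR x v x' v' y = n * ((Real.log v' - Real.log v) / 2) -
      (∑ i, (y i - x i) ^ 2) / (2 * v) + (∑ i, (y i - x' i) ^ 2) / (2 * v') := by
  simp [gaussVecLLR, gaussianLLR, Finset.sum_add_distrib, Finset.sum_div]

theorem measurable_gaussVecLLR (x : Fin n → ℝ) (v : ℝ) (x' : Fin n → ℝ) (v' : ℝ) :
    Measurable (gaussVecLLR x v x' v') := by
  unfold gaussVecLLR gaussianLLR; fun_prop

theorem gaussVec_eq_withDensity {v v' : ℝ} (hv : 0 < v) (hv' : 0 < v') (x x' : Fin n → ℝ) :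
    gaussVec x v = (gaussVec x' v').withDensity
      fun y => ENNReal.ofReal (Real.exp (gaussVecLLR x v x' v' y)) := by
  have h (i : Fin n) := gaussianReal_eq_withDensity hv hv' (x i) (x' i)
  have : ∀ i, SigmaFinite ((gaussianReal (x' i) v'.toNNReal).withDensity
      fun y => ENNReal.ofReal (Real.exp (gaussianLLR (x i) v (x' i) v' y))) := fun i => by
    rw [← h]; infer_instance
  unfold gaussVec
  simp_rw [h]
  rw [pi_withDensity _ fun i => (measurable_gaussianLLR _ _ _ _).exp.ennreal_ofReal]
  congr with y
  rw [gaussVecLLR, Real.exp_sum, ENNReal.ofReal_prod_of_nonneg fun i _ => (Real.exp_pos _).le]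

theorem map_prod_gaussVec {v v' : ℝ} (hv : 0 ≤ v) (hv' : 0 ≤ v') (x x' : Fin n → ℝ) (b c : ℝ) :
    ((gaussVec x v).prod (gaussVec x' v')).map (fun p => b • p.1 + c • p.2) =
      gaussVec (b • x + c • x') (b ^ 2 * v + c ^ 2 * v') := by
  refine (map_prod_pi _ _ (f := fun p : ℝ × ℝ => b * p.1 + c * p.2) (by fun_prop)).trans ?_
  simp_rw [map_prod_gaussianReal hv hv']
  rfl

theorem map_add_gaussVec (x x' : Fin n → ℝ) (v : ℝ) :
    (gaussVec x v).map (fun y => x' + y) = gaussVec (x' + x) v := by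
  unfold gaussVec
  refine (Measure.pi_map_pi (f := fun i y => x' i + y) fun i => by fun_prop).trans ?_
  simp_rw [gaussianReal_map_const_add]
  congr with i
  rw [Pi.add_apply, add_comm]

theorem integrable_eval_sub_sq_gaussVec (x b : Fin n → ℝ) (v : ℝ) (i : Fin n) :
    Integrable (fun y : Fin n → ℝ => (y i - b i) ^ 2) (gaussVec x v) := by
  refine integrable_comp_eval (X := fun _ : Fin n => ℝ) (f := fun t => (t - b i) ^ 2) (E := ℝ) ?_
  exact ((memLp_id_gaussianReal' 2 (by simp)).sub (memLp_const _)).integrable_sq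

theorem integrable_sum_sq_gaussVec (x b : Fin n → ℝ) (v : ℝ) :
    Integrable (fun y : Fin n → ℝ => ∑ i, (y i - b i) ^ 2) (gaussVec x v) :=
  integrable_finsetSum _ fun i _ => integrable_eval_sub_sq_gaussVec x b v i

theorem integrable_gaussVecLLR (x₀ : Fin n → ℝ) (v₀ : ℝ) (x : Fin n → ℝ) (v : ℝ) (x' : Fin n → ℝ)
    (v' : ℝ) : Integrable (gaussVecLLR x v x' v') (gaussVec x₀ v₀) := by
  simp_rw [funext (gaussVecLLR_eq x v x' v')]
  exact ((integrable_const _).sub ((integrable_sum_sq_gaussVec _ _ _).div_const _)).add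
    ((integrable_sum_sq_gaussVec _ _ _).div_const _)

theorem integral_sub_sq_gaussianReal (x b : ℝ) {v : ℝ} (hv : 0 ≤ v) :
    ∫ y, (y - b) ^ 2 ∂gaussianReal x v.toNNReal = v + (x - b) ^ 2 := by
  have hL : MemLp (fun y => y - b) 2 (gaussianReal x v.toNNReal) :=
    (memLp_id_gaussianReal' 2 (by simp)).sub (memLp_const _)
  have h := variance_eq_sub hL
  have h1 : ∫ y, (y - b) ∂gaussianReal x v.toNNReal = x - b := by
    have hi : Integrable (fun y : ℝ => y) (gaussianReal x v.toNNReal) :=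
      (memLp_id_gaussianReal' 1 (by simp)).integrable le_rfl
    rw [integral_sub hi (integrable_const _)]
    simp
  rw [variance_sub_const (by fun_prop), variance_fun_id_gaussianReal, h1,
    Real.coe_toNNReal _ hv] at h
  simp only [Pi.pow_apply] at h
  linarith

theorem integral_sum_sq_gaussVec (x b : Fin n → ℝ) {v : ℝ} (hv : 0 ≤ v) :
    ∫ y, ∑ i, (y i - b i) ^ 2 ∂gaussVec x v = n * v + ∑ i, (x i - b i) ^ 2 := by
  rw [integral_finsetSum _ fun i _ => integrable_eval_sub_sq_gaussVec x b v i]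
  have (i : Fin n) : ∫ y, (y i - b i) ^ 2 ∂gaussVec x v = v + (x i - b i) ^ 2 := by
    rw [← integral_sub_sq_gaussianReal _ _ hv]
    exact integral_comp_eval (μ := fun i => gaussianReal (x i) v.toNNReal)
      (f := fun t => (t - b i) ^ 2) (by fun_prop)
  simp_rw [this, Finset.sum_add_distrib]
  simp

/-- Chebyshev's inequality: the variance of a sum of independent squares grows only linearly in `n`.
-/
theorem gaussVec_sum_sq_concentration {v δ : ℝ} (hv : 0 ≤ v) (hδ : 0 < δ) (hn : 0 < n) :
    gaussVec (0 : Fin n → ℝ) v {y | n * δ ≤ |∑ i, y i ^ 2 - n * v|} ≤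
      ENNReal.ofReal (Var[fun y => y ^ 2; gaussianReal 0 v.toNNReal] / δ ^ 2 / n) := by
  -- The finite fourth moment of a Gaussian makes its square square-integrable.
  have hL : MemLp (fun y : ℝ => y ^ 2) 2 (gaussianReal 0 v.toNNReal) := by
    have := (memLp_id_gaussianReal' (μ := 0) (v := v.toNNReal) 4 (by simp)).norm_rpow_div 2
    refine (this.congr_norm (by fun_prop) (ae_of_all _ fun y => ?_)).mono_exponent ?_
    · simp
    · rw [ENNReal.le_div_iff_mul_le (by simp) (by simp)]; norm_num
  have hS : MemLp (∑ i : Fin n, fun y : Fin n → ℝ => y i ^ 2) 2 (gaussVec 0 v) :=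
    memLp_finsetSum' _ fun i _ => hL.comp_measurePreserving
      (measurePreserving_eval (fun i : Fin n => gaussianReal ((0 : Fin n → ℝ) i) v.toNNReal) i)
  have hvar : Var[∑ i : Fin n, fun y : Fin n → ℝ => y i ^ 2; gaussVec 0 v] =
      n * Var[fun y => y ^ 2; gaussianReal 0 v.toNNReal] := by
    refine (variance_sum_pi (X := fun _ y => y ^ 2) fun i => hL).trans ?_
    simp
  have hc := meas_ge_le_variance_div_sq hS (c := n * δ) (by positivity)
  have hmean : ∫ y, (∑ i : Fin n, fun y : Fin n → ℝ => y i ^ 2) y ∂gaussVec 0 v = n * v := by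
    simpa using integral_sum_sq_gaussVec (0 : Fin n → ℝ) 0 hv
  rw [hmean, hvar] at hc
  simp only [Finset.sum_apply] at hc
  refine hc.trans_eq ?_
  congr 1
  field_simp

end GaussVec

/-! ### Error probabilities as averages over messages. -/

theorem lintegral_uniformOn_univ {M : ℕ} (f : Fin M → ENNReal) :
    ∫⁻ w, f w ∂uniformOn (Set.univ : Set (Fin M)) = (M : ENNReal)⁻¹ * ∑ w, f w := by
  rw [uniformOn, ProbabilityTheory.cond, lintegral_smul_measure, Measure.restrict_univ,
    lintegral_count, tsum_fintype, Measure.count_univ]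
  simp

namespace InterferenceCode

variable {P₁ P₂ : ℝ} {n : ℕ}

theorem law_apply (c : InterferenceCode P₁ P₂ n) (N : ℝ)
    {E : Set (Fin c.M₁ × Fin c.M₂ × (Fin n → ℝ))} (hE : MeasurableSet E) :
    c.law N E = (c.M₁ : ENNReal)⁻¹ * ∑ u, (c.M₂ : ENNReal)⁻¹ * ∑ w,
      gaussVec (0 : Fin n → ℝ) N {z | (u, w, z) ∈ E} := by
  have : NeZero c.M₁ := ⟨c.M₁_pos.ne'⟩
  have : NeZero c.M₂ := ⟨c.M₂_pos.ne'⟩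
  rw [law, Measure.prod_apply hE, lintegral_uniformOn_univ]
  congr! with u
  rw [Measure.prod_apply (measurable_prodMk_left hE), lintegral_uniformOn_univ]
  rfl

theorem law_real_eq (c : InterferenceCode P₁ P₂ n) (N : ℝ)
    {E : Set (Fin c.M₁ × Fin c.M₂ × (Fin n → ℝ))} (hE : MeasurableSet E) :
    (c.law N).real E = (c.M₁ : ℝ)⁻¹ * ∑ u, (c.M₂ : ℝ)⁻¹ * ∑ w,
      (gaussVec (0 : Fin n → ℝ) N).real {z | (u, w, z) ∈ E} := by
  rw [Measure.real, law_apply c N hE]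
  have hfin (u w) : gaussVec (0 : Fin n → ℝ) N {z | (u, w, z) ∈ E} ≠ ⊤ := measure_ne_top _ _
  simp only [ENNReal.toReal_mul, ENNReal.toReal_inv, ENNReal.toReal_natCast]
  rw [ENNReal.toReal_sum fun u _ => ENNReal.mul_ne_top
    (ENNReal.inv_ne_top.2 (by exact_mod_cast c.M₂_pos.ne'))
    (ENNReal.sum_ne_top.2 fun w _ => hfin u w)]
  simp only [ENNReal.toReal_mul, ENNReal.toReal_inv, ENNReal.toReal_natCast]
  congr! with u
  exact ENNReal.toReal_sum fun w _ => hfin u w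

theorem error₁_eq (c : InterferenceCode P₁ P₂ n) (N : ℝ) :
    c.error₁ N = (c.M₁ : ℝ)⁻¹ * ∑ u, (gaussVec (c.enc₁ u) N).real {y | c.dec₁ y ≠ u} := by
  have hM : (c.M₂ : ℝ) ≠ 0 := by exact_mod_cast c.M₂_pos.ne'
  have hd := c.measurable_dec₁
  have he : Measurable c.enc₁ := measurable_of_finite _
  rw [error₁, law_real_eq]
  · congr! 2 with u
    have hm : MeasurableSet {y | c.dec₁ y ≠ u} := (hd (measurableSet_singleton u)).compl
    have h := map_add_gaussVec 0 (c.enc₁ u) N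
    rw [add_zero] at h
    rw [← h, map_measureReal_apply (by fun_prop) hm]
    exact (congrArg _ (by simp)).trans (inv_mul_cancel_left₀ hM _)
  · exact (measurableSet_eq_fun (hd.comp (by fun_prop)) measurable_fst).compl

/-- The codeword of user 2 is kept apart from the interference plus noise, whose average over `u`
will be read as a Gaussian mixture. -/
theorem error₂_eq (c : InterferenceCode P₁ P₂ n) (a N : ℝ) :
    c.error₂ a N = (c.M₂ : ℝ)⁻¹ * ∑ w, (c.M₁ : ℝ)⁻¹ * ∑ u,
      (gaussVec (Real.sqrt a • c.enc₁ u) N).real {s | c.dec₂ (c.enc₂ w + s) ≠ w} := by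
  have hd := c.measurable_dec₂
  have he : Measurable c.enc₁ := measurable_of_finite _
  have he' : Measurable c.enc₂ := measurable_of_finite _
  rw [error₂, law_real_eq]
  · simp_rw [Finset.mul_sum]
    rw [Finset.sum_comm]
    congr! 2 with w _ u
    have hm : MeasurableSet {s | c.dec₂ (c.enc₂ w + s) ≠ w} :=
      ((hd.comp (measurable_const_add _)) (measurableSet_singleton w)).compl
    have h := map_add_gaussVec 0 (Real.sqrt a • c.enc₁ u) N
    rw [add_zero] at h
    rw [← h, map_measureReal_apply (by fun_prop) hm, mul_left_comm]
    simp only [Set.preimage_ofPred_eq, Set.mem_ofPred_eq, add_assoc]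
  · exact (measurableSet_eq_fun (hd.comp (by fun_prop)) (by fun_prop)).compl

end InterferenceCode

/-! ### The variational inequality for relative entropy. -/

section Gibbs

variable {Ω : Type*} [MeasurableSpace Ω]

/-- Integrate `x + 1 ≤ exp x` at `x = φ - l` against `P`; the density turns the right side into an
integral against `Q`. This is the Gibbs bound with `log t` relaxed to `t - 1`, so that the terms of
different messages can be summed. -/
theorem integral_le_of_withDensity_exp {P Q : Measure Ω} [IsProbabilityMeasure P]
    {l φ : Ω → ℝ} (hPQ : P = Q.withDensity fun ω => ENNReal.ofReal (Real.exp (l ω)))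
    (hlm : Measurable l) (hl : Integrable l P) (hφ : Integrable φ P)
    (hexp : Integrable (fun ω => Real.exp (φ ω)) Q) :
    ∫ ω, φ ω ∂P ≤ ∫ ω, l ω ∂P + ∫ ω, Real.exp (φ ω) ∂Q - 1 := by
  have hm : Measurable fun ω => ENNReal.ofReal (Real.exp (l ω)) := hlm.exp.ennreal_ofReal
  have hsmul (ω : Ω) : (ENNReal.ofReal (Real.exp (l ω))).toReal • Real.exp (φ ω - l ω) =
      Real.exp (φ ω) := by
    rw [ENNReal.toReal_ofReal (Real.exp_pos _).le, smul_eq_mul, ← Real.exp_add]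
    congr 1; ring
  have hint : Integrable (fun ω => Real.exp (φ ω - l ω)) P := by
    rw [hPQ, integrable_withDensity_iff_integrable_smul' hm (ae_of_all _ fun _ => by simp)]
    simpa only [hsmul] using hexp
  have heq : ∫ ω, Real.exp (φ ω - l ω) ∂P = ∫ ω, Real.exp (φ ω) ∂Q := by
    rw [hPQ, integral_withDensity_eq_integral_toReal_smul hm (ae_of_all _ fun _ => by simp)]
    simp only [hsmul]
  have h := integral_mono ((hφ.sub hl).add (integrable_const 1)) hint
    fun ω => Real.add_one_le_exp (φ ω - l ω)
  rw [heq, integral_add' (hφ.sub hl) (integrable_const 1), integral_sub' hφ hl] at h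
  simp at h
  linarith

/-- A change of measure bound that combines Fano's inequality (for the set `A` of correct
decoding) and the variational formula for relative entropy. -/
theorem log_mul_measureReal_add_integral_le {P Q : Measure Ω} [IsProbabilityMeasure P]
    {l ψ : Ω → ℝ} (hPQ : P = Q.withDensity fun ω => ENNReal.ofReal (Real.exp (l ω)))
    (hlm : Measurable l) (hl : Integrable l P) (hψ : Integrable ψ P)
    (hexp : Integrable (fun ω => Real.exp (ψ ω)) Q) (hone : ∫ ω, Real.exp (ψ ω) ∂Q = 1)
    {A : Set Ω} (hA : MeasurableSet A) {M : ℝ} (hM : 0 < M) :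
    Real.log M * P.real A + ∫ ω, ψ ω ∂P ≤
      ∫ ω, l ω ∂P + (M - 1) * ∫ ω in A, Real.exp (ψ ω) ∂Q := by
  classical
  have h1 : Integrable (A.indicator fun _ => Real.log M) P := (integrable_const _).indicator hA
  -- The test function is `ψ` raised by `log M` on `A`, so its exponential is that of `ψ` multiplied
  -- by `M` on `A`.
  have h2 : (fun ω => Real.exp ((A.indicator (fun _ => Real.log M) + ψ) ω)) =
      fun ω => Real.exp (ψ ω) + (M - 1) * A.indicator (fun ω => Real.exp (ψ ω)) ω := by
    ext ω
    by_cases hω : ω ∈ A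
    · simp only [Pi.add_apply, Set.indicator_of_mem hω, Real.exp_add, Real.exp_log hM]; ring
    · simp [Set.indicator_of_notMem hω]
  have h3 : Integrable (fun ω => (M - 1) * A.indicator (fun ω => Real.exp (ψ ω)) ω) Q :=
    (hexp.indicator hA).const_mul _
  have h := integral_le_of_withDensity_exp hPQ hlm hl (h1.add hψ) (by rw [h2]; exact hexp.add h3)
  rw [h2, integral_add hexp h3, integral_const_mul, integral_indicator hA, hone,
    integral_add' h1 hψ, integral_indicator hA, setIntegral_const, smul_eq_mul] at h
  linarith

theorem sum_setIntegral_fiber {M : ℕ} {Q : Measure Ω} {d : Ω → Fin M} (hd : Measurable d)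
    {f : Ω → ℝ} (hf : Integrable f Q) : ∑ w, ∫ ω in {ω | d ω = w}, f ω ∂Q = ∫ ω, f ω ∂Q := by
  change ∑ w, ∫ ω in d ⁻¹' {w}, f ω ∂Q = _
  rw [← integral_iUnion_fintype (fun w => hd (measurableSet_singleton w))
    (fun w w' h => Set.disjoint_left.2 fun ω h1 h2 => h (h1.symm.trans h2))
    (fun w => hf.integrableOn), Set.iUnion_eq_univ_iff.2 fun ω => ⟨d ω, rfl⟩,
    Measure.restrict_univ]

end Gibbs

/-! ### Mixtures of Gaussian vectors. -/

section Mixture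

variable {n M : ℕ}

/-- The uniform mixture of Gaussian vectors with means `t u` and variance `v`. -/
noncomputable def gaussMix (t : Fin M → Fin n → ℝ) (v : ℝ) : Measure (Fin n → ℝ) :=
  (M : ENNReal)⁻¹ • ∑ u, gaussVec (t u) v

/-- The logarithm of the density of `gaussMix t v` with respect to `gaussVec 0 v'`. -/
noncomputable def gaussMixLLR (t : Fin M → Fin n → ℝ) (v v' : ℝ) (y : Fin n → ℝ) : ℝ :=
  Real.log ((M : ℝ)⁻¹ * ∑ u, Real.exp (gaussVecLLR (t u) v 0 v' y))

theorem measurable_gaussMixLLR (t : Fin M → Fin n → ℝ) (v v' : ℝ) :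
    Measurable (gaussMixLLR t v v') := by
  have := fun u => measurable_gaussVecLLR (t u) v 0 v'
  unfold gaussMixLLR
  fun_prop

theorem gaussMix_isProbabilityMeasure (hM : 0 < M) (t : Fin M → Fin n → ℝ) (v : ℝ) :
    IsProbabilityMeasure (gaussMix t v) := by
  constructor
  simp only [gaussMix, Measure.smul_apply, Measure.finsetSum_apply, measure_univ, smul_eq_mul]
  simpa using ENNReal.inv_mul_cancel (by exact_mod_cast hM.ne') (by simp)

theorem exp_gaussMixLLR (hM : 0 < M) (t : Fin M → Fin n → ℝ) (v v' : ℝ) (y : Fin n → ℝ) :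
    Real.exp (gaussMixLLR t v v' y) =
      (M : ℝ)⁻¹ * ∑ u, Real.exp (gaussVecLLR (t u) v 0 v' y) := by
  have : Nonempty (Fin M) := ⟨⟨0, hM⟩⟩
  have hM' : (0 : ℝ) < M := by exact_mod_cast hM
  exact Real.exp_log (mul_pos (inv_pos.2 hM')
    (Finset.sum_pos (fun u _ => Real.exp_pos _) Finset.univ_nonempty))

theorem gaussMix_eq_withDensity (hM : 0 < M) (t : Fin M → Fin n → ℝ) {v v' : ℝ} (hv : 0 < v)
    (hv' : 0 < v') : gaussMix t v = (gaussVec 0 v').withDensity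
      fun y => ENNReal.ofReal (Real.exp (gaussMixLLR t v v' y)) := by
  have hM' : (0 : ℝ) < M := by exact_mod_cast hM
  have hm (u : Fin M) : Measurable fun y =>
      ENNReal.ofReal (Real.exp (gaussVecLLR (t u) v 0 v' y)) :=
    (measurable_gaussVecLLR (t u) v 0 v').exp.ennreal_ofReal
  ext s hs
  simp_rw [withDensity_apply _ hs, exp_gaussMixLLR hM,
    ENNReal.ofReal_mul (inv_pos.2 hM').le,
    ENNReal.ofReal_sum_of_nonneg fun u _ => (Real.exp_pos (gaussVecLLR (t u) v 0 v' _)).le]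
  rw [lintegral_const_mul _ (Finset.measurable_fun_sum _ fun u _ => hm u),
    lintegral_finsetSum _ fun u _ => hm u, ENNReal.ofReal_inv_of_pos hM', ENNReal.ofReal_natCast]
  simp only [gaussMix, Measure.smul_apply, Measure.finsetSum_apply, smul_eq_mul]
  congr! 2 with u
  rw [gaussVec_eq_withDensity hv hv' (t u) 0, withDensity_apply _ hs]

theorem integrable_gaussMix (hM : 0 < M) {t : Fin M → Fin n → ℝ} {v : ℝ} {f : (Fin n → ℝ) → ℝ}
    (hf : ∀ u, Integrable f (gaussVec (t u) v)) : Integrable f (gaussMix t v) :=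
  (integrable_finsetSum_measure.2 fun u _ => hf u).smul_measure
    (ENNReal.inv_ne_top.2 (by exact_mod_cast hM.ne'))

theorem integral_gaussMix {t : Fin M → Fin n → ℝ} {v : ℝ} {f : (Fin n → ℝ) → ℝ}
    (hf : ∀ u, Integrable f (gaussVec (t u) v)) :
    ∫ y, f y ∂gaussMix t v = (M : ℝ)⁻¹ * ∑ u, ∫ y, f y ∂gaussVec (t u) v := by
  rw [gaussMix, integral_smul_measure, integral_finsetSum_measure fun u _ => hf u]
  simp

theorem gaussMix_real_apply (t : Fin M → Fin n → ℝ) (v : ℝ) (s : Set (Fin n → ℝ)) :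
    (gaussMix t v).real s = (M : ℝ)⁻¹ * ∑ u, (gaussVec (t u) v).real s := by
  simp [Measure.real, gaussMix, ENNReal.toReal_sum]

/-- An average of exponentials lies between the exponentials of common bounds for the exponents.
Integrability of the mixture log-density reduces in this way to that of quadratic functions. -/
theorem abs_gaussMixLLR_le (hM : 0 < M) (t : Fin M → Fin n → ℝ) (v v' : ℝ) (y : Fin n → ℝ) :
    |gaussMixLLR t v v' y| ≤ ∑ u, |gaussVecLLR (t u) v 0 v' y| := by
  set B := ∑ u, |gaussVecLLR (t u) v 0 v' y|
  have hM' : (0 : ℝ) < M := by exact_mod_cast hM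
  have hB (u : Fin M) : |gaussVecLLR (t u) v 0 v' y| ≤ B :=
    Finset.single_le_sum (f := fun u => |gaussVecLLR (t u) v 0 v' y|)
      (fun u _ => abs_nonneg _) (Finset.mem_univ u)
  have hconst (b : ℝ) : (M : ℝ)⁻¹ * ∑ _u : Fin M, b = b := by
    simp [hM'.ne']
  rw [abs_le, ← Real.exp_le_exp, ← Real.exp_le_exp (y := B), exp_gaussMixLLR hM]
  constructor
  · rw [← hconst (Real.exp (-B))]
    gcongr with u
    exact neg_le_of_abs_le (hB u)
  · rw [← hconst (Real.exp B)]
    gcongr with u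
    exact le_of_abs_le (hB u)

theorem integrable_gaussMixLLR (hM : 0 < M) (t : Fin M → Fin n → ℝ) (v v' : ℝ) (x : Fin n → ℝ)
    (v₀ : ℝ) : Integrable (gaussMixLLR t v v') (gaussVec x v₀) := by
  refine (integrable_finsetSum Finset.univ fun u _ =>
    (integrable_gaussVecLLR x v₀ (t u) v 0 v').abs).mono'
    (measurable_gaussMixLLR t v v').aestronglyMeasurable (ae_of_all _ fun y => ?_)
  exact abs_gaussMixLLR_le hM t v v' y

theorem integrable_exp_of_withDensity {Ω : Type*} [MeasurableSpace Ω] {P Q : Measure Ω}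
    [IsProbabilityMeasure P] {l : Ω → ℝ} (hl : Measurable l)
    (hPQ : P = Q.withDensity fun ω => ENNReal.ofReal (Real.exp (l ω))) :
    Integrable (fun ω => Real.exp (l ω)) Q ∧ ∫ ω, Real.exp (l ω) ∂Q = 1 := by
  have h1 : ∫⁻ ω, ENNReal.ofReal (Real.exp (l ω)) ∂Q = 1 := by
    rw [← setLIntegral_univ, ← withDensity_apply _ .univ, ← hPQ, measure_univ]
  constructor
  · refine ⟨hl.exp.aestronglyMeasurable, ?_⟩
    rw [hasFiniteIntegral_iff_ofReal (ae_of_all _ fun _ => (Real.exp_pos _).le), h1]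
    exact ENNReal.one_lt_top
  · rw [integral_eq_lintegral_of_nonneg_ae (ae_of_all _ fun _ => (Real.exp_pos _).le)
      hl.exp.aestronglyMeasurable, h1, ENNReal.toReal_one]

end Mixture

/-! ### The converse. -/

section Converse

variable {n M : ℕ}

/-- If the codewords `x u` can be recovered by `d` after adding noise of variance `N`, then the
relative entropy of the degraded output mixture with respect to a Gaussian vector is small. -/
theorem log_mul_add_integral_gaussMixLLR_le (hM : 0 < M) (x : Fin M → Fin n → ℝ)
    {d : (Fin n → ℝ) → Fin M} (hd : Measurable d) {a N V : ℝ} (ha₀ : 0 ≤ a) (ha₁ : a ≤ 1)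
    (hN : 0 < N) (hV : 0 < V) (hs : 0 < a * V + (1 - a) * N) :
    Real.log M * ((M : ℝ)⁻¹ * ∑ u, (gaussVec (x u) N).real {y | d y = u}) +
      ∫ s, gaussMixLLR (fun u => Real.sqrt a • x u) N (a * V + (1 - a) * N) s
        ∂gaussMix (fun u => Real.sqrt a • x u) N ≤
      (M : ℝ)⁻¹ * ∑ u, ∫ y, gaussVecLLR (x u) N 0 V y ∂gaussVec (x u) N + 1 := by
  have hM' : (0 : ℝ) < M := by exact_mod_cast hM
  set s2 := a * V + (1 - a) * N with hs2
  set t : Fin M → Fin n → ℝ := fun u => Real.sqrt a • x u with ht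
  set ψ := gaussMixLLR t N s2 with hψ
  have hψm : Measurable ψ := measurable_gaussMixLLR t N s2
  -- The degradation map: it scales the signal by `√a`, and the fresh noise restores the noise
  -- variance to `N`.
  let T : (Fin n → ℝ) × (Fin n → ℝ) → Fin n → ℝ :=
    fun p => Real.sqrt a • p.1 + Real.sqrt (1 - a) • p.2
  have hT : Measurable T := by fun_prop
  let P : Fin M → Measure ((Fin n → ℝ) × (Fin n → ℝ)) :=
    fun u => (gaussVec (x u) N).prod (gaussVec 0 N)
  let Q : Measure ((Fin n → ℝ) × (Fin n → ℝ)) := (gaussVec 0 V).prod (gaussVec 0 N)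
  have hsa : Real.sqrt a ^ 2 = a := Real.sq_sqrt ha₀
  have hsb : Real.sqrt (1 - a) ^ 2 = 1 - a := Real.sq_sqrt (by linarith)
  have hTP (u) : (P u).map T = gaussVec (t u) N := by
    have h := map_prod_gaussVec hN.le hN.le (x u) 0 (Real.sqrt a) (Real.sqrt (1 - a))
    rw [hsa, hsb, smul_zero, add_zero, show a * N + (1 - a) * N = N by ring] at h
    exact h
  have hTQ : Q.map T = gaussVec 0 s2 := by
    have h := map_prod_gaussVec hV.le hN.le (0 : Fin n → ℝ) 0 (Real.sqrt a) (Real.sqrt (1 - a))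
    rw [hsa, hsb, smul_zero, smul_zero, add_zero] at h
    exact h
  have hPQ (u) : P u = Q.withDensity
      fun p => ENNReal.ofReal (Real.exp (gaussVecLLR (x u) N 0 V p.1)) := by
    have h := gaussVec_eq_withDensity hN hV (x u) 0
    have hm : Measurable fun y => ENNReal.ofReal (Real.exp (gaussVecLLR (x u) N 0 V y)) :=
      (measurable_gaussVecLLR _ _ _ _).exp.ennreal_ofReal
    have : SFinite ((gaussVec 0 V).withDensity
        fun y => ENNReal.ofReal (Real.exp (gaussVecLLR (x u) N 0 V y))) := by
      rw [← h]; infer_instance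
    change (gaussVec (x u) N).prod (gaussVec 0 N) = _
    rw [h, prod_withDensity_left hm]
  have hfst (u) {f : (Fin n → ℝ) → ℝ} (hf : Integrable f (gaussVec (x u) N)) :
      Integrable (fun p => f p.1) (P u) ∧
        ∫ p, f p.1 ∂P u = ∫ y, f y ∂gaussVec (x u) N := by
    refine ⟨hf.comp_fst _, ?_⟩
    rw [integral_fun_fst]
    simp
  have hmix := gaussMix_isProbabilityMeasure hM t N
  obtain ⟨hei, he1⟩ := integrable_exp_of_withDensity hψm (gaussMix_eq_withDensity hM t hN hs)
  have hei' : Integrable (fun p => Real.exp (ψ (T p))) Q := by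
    rw [← hTQ] at hei
    exact hei.comp_measurable hT
  have he1' : ∫ p, Real.exp (ψ (T p)) ∂Q = 1 := by
    rw [← he1, ← hTQ, integral_map hT.aemeasurable hψm.exp.aestronglyMeasurable]
  have hψi (u) : Integrable ψ (gaussVec (t u) N) := integrable_gaussMixLLR hM t N s2 _ _
  have hψP (u) : Integrable (fun p => ψ (T p)) (P u) ∧
      ∫ p, ψ (T p) ∂P u = ∫ s, ψ s ∂gaussVec (t u) N := by
    have h := hψi u
    rw [← hTP u] at h ⊢
    exact ⟨h.comp_measurable hT,
      (integral_map hT.aemeasurable hψm.aestronglyMeasurable).symm⟩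
  have hA (u : Fin M) : MeasurableSet {y | d y = u} := hd (measurableSet_singleton u)
  have key (u : Fin M) : Real.log M * (gaussVec (x u) N).real {y | d y = u} +
      ∫ s, ψ s ∂gaussVec (t u) N ≤ ∫ y, gaussVecLLR (x u) N 0 V y ∂gaussVec (x u) N +
        (M - 1) * ∫ p in {p | d p.1 = u}, Real.exp (ψ (T p)) ∂Q := by
    have hl := hfst u (integrable_gaussVecLLR (x u) N (x u) N 0 V)
    have h := log_mul_measureReal_add_integral_le (hPQ u)
      ((measurable_gaussVecLLR (x u) N 0 V).comp measurable_fst) hl.1 (hψP u).1 hei' he1'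
      (A := {p | d p.1 = u}) (measurable_fst (hA u)) hM'
    rw [(hψP u).2, hl.2] at h
    have hreal : (P u).real {p | d p.1 = u} = (gaussVec (x u) N).real {y | d y = u} := by
      have : {p : (Fin n → ℝ) × (Fin n → ℝ) | d p.1 = u} = {y | d y = u} ×ˢ Set.univ := by
        ext; simp
      rw [this, measureReal_prod_prod]
      simp
    rwa [hreal] at h
  have hsum := Finset.sum_le_sum fun u (_ : u ∈ Finset.univ) => key u
  -- The decoding regions partition the space and `exp (ψ ∘ T)` has total mass one under `Q`, so the
  -- last terms add up to `M - 1`. After division by `M` this is the additive constant 1.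
  rw [Finset.sum_add_distrib, Finset.sum_add_distrib, ← Finset.mul_sum, ← Finset.mul_sum,
    sum_setIntegral_fiber (d := fun p : (Fin n → ℝ) × (Fin n → ℝ) => d p.1)
      (hd.comp measurable_fst) hei', he1'] at hsum
  rw [integral_gaussMix hψi]
  have h := mul_le_mul_of_nonneg_left hsum (inv_pos.2 hM').le
  have hle : (M : ℝ)⁻¹ * ((M - 1) * 1) ≤ 1 := by
    rw [inv_mul_le_iff₀ hM']; linarith
  calc _ = (M : ℝ)⁻¹ * (Real.log M * ∑ u, (gaussVec (x u) N).real {y | d y = u} +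
        ∑ u, ∫ s, ψ s ∂gaussVec (t u) N) := by ring
    _ ≤ _ := h
    _ ≤ _ := by rw [mul_add]; linarith

/-- Fano's inequality for messages sent over noise distributed as a mixture of Gaussian vectors. -/
theorem log_mul_le_integral_gaussMixLLR {M₂ : ℕ} (hM : 0 < M) (hM₂ : 0 < M₂)
    (t : Fin M → Fin n → ℝ) (x : Fin M₂ → Fin n → ℝ) (m : Fin n → ℝ)
    {d : (Fin n → ℝ) → Fin M₂} (hd : Measurable d) {N s σ : ℝ} (hN : 0 < N) (hs : 0 < s)
    (hσ : 0 < σ) :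
    Real.log M₂ * ((M₂ : ℝ)⁻¹ * ∑ w, (gaussMix t N).real {y | d (x w + y) = w}) ≤
      ∫ y, gaussMixLLR t N s y ∂gaussMix t N +
        (M₂ : ℝ)⁻¹ * ∑ w, ∫ y, gaussVecLLR 0 s (m - x w) σ y ∂gaussMix t N + 1 := by
  have hM' : (0 : ℝ) < M₂ := by exact_mod_cast hM₂
  have hmix := gaussMix_isProbabilityMeasure hM t N
  have hψm := measurable_gaussMixLLR t N s
  have hLm (w) := measurable_gaussVecLLR 0 s (m - x w) σ
  have hψi : Integrable (gaussMixLLR t N s) (gaussMix t N) :=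
    integrable_gaussMix hM fun u => integrable_gaussMixLLR hM t N s _ _
  have hLi (w) : Integrable (gaussVecLLR 0 s (m - x w) σ) (gaussMix t N) :=
    integrable_gaussMix hM fun u => integrable_gaussVecLLR _ _ _ _ _ _
  -- Chain rule for densities through `gaussVec 0 s`: it isolates the relative entropy of the
  -- mixture, which does not depend on `w`.
  have hPQ (w) : gaussMix t N = (gaussVec (m - x w) σ).withDensity fun y =>
      ENNReal.ofReal (Real.exp (gaussMixLLR t N s y + gaussVecLLR 0 s (m - x w) σ y)) := by
    conv_lhs => rw [gaussMix_eq_withDensity hM t hN hs, gaussVec_eq_withDensity hs hσ 0 (m - x w),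
      ← withDensity_mul _ (hLm w).exp.ennreal_ofReal hψm.exp.ennreal_ofReal]
    congr with y
    rw [Pi.mul_apply, ← ENNReal.ofReal_mul (Real.exp_pos _).le, ← Real.exp_add, add_comm]
  have hA (w : Fin M₂) : MeasurableSet {y | d (x w + y) = w} :=
    (hd.comp (measurable_const_add _)) (measurableSet_singleton w)
  have hB (w : Fin M₂) : MeasurableSet {y | d y = w} := hd (measurableSet_singleton w)
  have key (w : Fin M₂) : Real.log M₂ * (gaussMix t N).real {y | d (x w + y) = w} ≤
      ∫ y, gaussMixLLR t N s y ∂gaussMix t N + ∫ y, gaussVecLLR 0 s (m - x w) σ y ∂gaussMix t N +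
        (M₂ - 1) * ∫ y in {y | d y = w}, 1 ∂gaussVec m σ := by
    -- With `ψ = 0` only the Fano part of the bound remains.
    have h := log_mul_measureReal_add_integral_le (ψ := fun _ => 0) (hPQ w) (hψm.add (hLm w))
      (hψi.add (hLi w)) (integrable_const 0) (by simp) (by simp) (hA w) hM'
    rw [integral_add hψi (hLi w)] at h
    have hmap := map_add_gaussVec (m - x w) (x w) σ
    rw [add_sub_cancel] at hmap
    have hreal : (gaussVec m σ).real {y | d y = w} =
        (gaussVec (m - x w) σ).real {y | d (x w + y) = w} := by
      rw [← hmap, map_measureReal_apply (by fun_prop) (hB w)]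
      rfl
    simp only [integral_zero, add_zero, Real.exp_zero, setIntegral_const, smul_eq_mul, mul_one]
      at h ⊢
    rwa [hreal]
  have hsum := Finset.sum_le_sum fun w (_ : w ∈ Finset.univ) => key w
  rw [Finset.sum_add_distrib, Finset.sum_add_distrib, ← Finset.mul_sum, ← Finset.mul_sum,
    sum_setIntegral_fiber hd (integrable_const (1 : ℝ))] at hsum
  simp only [Finset.sum_const, Finset.card_univ, Fintype.card_fin, nsmul_eq_mul, integral_const,
    probReal_univ, smul_eq_mul, mul_one] at hsum
  have h := mul_le_mul_of_nonneg_left hsum (inv_pos.2 hM').le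
  have hle : (M₂ : ℝ)⁻¹ * (M₂ - 1) ≤ 1 := by
    rw [inv_mul_le_iff₀ hM']; linarith
  calc _ = (M₂ : ℝ)⁻¹ * (Real.log M₂ * ∑ w, (gaussMix t N).real {y | d (x w + y) = w}) := by ring
    _ ≤ _ := h
    _ ≤ _ := by rw [mul_add, mul_add, inv_mul_cancel_left₀ hM'.ne']; linarith

theorem integral_gaussVecLLR (x₀ x x' : Fin n → ℝ) {v₀ : ℝ} (hv₀ : 0 ≤ v₀) (v v' : ℝ) :
    ∫ y, gaussVecLLR x v x' v' y ∂gaussVec x₀ v₀ = n * ((Real.log v' - Real.log v) / 2) -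
      (n * v₀ + ∑ i, (x₀ i - x i) ^ 2) / (2 * v) +
      (n * v₀ + ∑ i, (x₀ i - x' i) ^ 2) / (2 * v') := by
  simp_rw [gaussVecLLR_eq x v x' v']
  have h1 := (integrable_sum_sq_gaussVec x₀ x v₀).div_const (2 * v)
  have h2 := (integrable_sum_sq_gaussVec x₀ x' v₀).div_const (2 * v')
  have h3 : Integrable (fun y => n * ((Real.log v' - Real.log v) / 2) -
      (∑ i, (y i - x i) ^ 2) / (2 * v)) (gaussVec x₀ v₀) := (integrable_const _).sub h1
  rw [integral_add h3 h2, integral_sub (integrable_const _) h1, integral_div, integral_div,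
    integral_sum_sq_gaussVec _ _ hv₀, integral_sum_sq_gaussVec _ _ hv₀]
  simp

theorem inv_mul_sum_sub_div_add_div (hM : 0 < M) (f g : Fin M → ℝ) (A B k l : ℝ) :
    (M : ℝ)⁻¹ * ∑ u, (A - (B + f u) / k + (B + g u) / l) =
      A - (B + (M : ℝ)⁻¹ * ∑ u, f u) / k + (B + (M : ℝ)⁻¹ * ∑ u, g u) / l := by
  have hM' : (M : ℝ) ≠ 0 := by exact_mod_cast hM.ne'
  rw [Finset.sum_add_distrib, Finset.sum_sub_distrib, ← Finset.sum_div, ← Finset.sum_div,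
    Finset.sum_add_distrib, Finset.sum_add_distrib]
  simp only [Finset.sum_const, Finset.card_univ, Fintype.card_fin, nsmul_eq_mul]
  field_simp

end Converse

theorem gaussianCapacity_eq {P V : ℝ} (hP : 0 ≤ P) (hV : 0 < V) :
    gaussianCapacity P V = (Real.log (P + V) - Real.log V) / 2 := by
  rw [gaussianCapacity, ← Real.log_div (by positivity) hV.ne', add_div, div_self hV.ne', add_comm]
  ring

namespace InterferenceCode

variable {P₁ P₂ : ℝ} {n : ℕ}

theorem one_sub_error₁ (c : InterferenceCode P₁ P₂ n) (N : ℝ) :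
    1 - c.error₁ N = (c.M₁ : ℝ)⁻¹ * ∑ u, (gaussVec (c.enc₁ u) N).real {y | c.dec₁ y = u} := by
  have hM : (c.M₁ : ℝ) ≠ 0 := by exact_mod_cast c.M₁_pos.ne'
  have h (u) : (gaussVec (c.enc₁ u) N).real {y | c.dec₁ y ≠ u} =
      1 - (gaussVec (c.enc₁ u) N).real {y | c.dec₁ y = u} :=
    probReal_compl_eq_one_sub (c.measurable_dec₁ (measurableSet_singleton u))
  rw [error₁_eq]
  simp_rw [h, Finset.sum_sub_distrib]
  simp [mul_sub, hM]

theorem one_sub_error₂ (c : InterferenceCode P₁ P₂ n) (a N : ℝ) :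
    1 - c.error₂ a N = (c.M₂ : ℝ)⁻¹ * ∑ w,
      (gaussMix (fun u => Real.sqrt a • c.enc₁ u) N).real {s | c.dec₂ (c.enc₂ w + s) = w} := by
  have hM : (c.M₁ : ℝ) ≠ 0 := by exact_mod_cast c.M₁_pos.ne'
  have hM₂ : (c.M₂ : ℝ) ≠ 0 := by exact_mod_cast c.M₂_pos.ne'
  have h (u w) : (gaussVec (Real.sqrt a • c.enc₁ u) N).real {s | c.dec₂ (c.enc₂ w + s) ≠ w} =
      1 - (gaussVec (Real.sqrt a • c.enc₁ u) N).real {s | c.dec₂ (c.enc₂ w + s) = w} :=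
    probReal_compl_eq_one_sub
      ((c.measurable_dec₂.comp (measurable_const_add _)) (measurableSet_singleton w))
  rw [error₂_eq]
  simp_rw [h, gaussMix_real_apply, Finset.sum_sub_distrib]
  simp [mul_sub, hM, hM₂]

/-- The sum of the two Fano bounds: the relative entropy of the interference plus noise enters them
with opposite signs, and the rest is a computation with second moments. -/
theorem one_sub_error₂_mul_log_le (c : InterferenceCode P₁ P₂ n) {a N : ℝ} (ha₀ : 0 ≤ a)
    (ha₁ : a < 1) (hN : 0 < N) (hP₁ : 0 ≤ P₁) (hP₂ : 0 ≤ P₂) :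
    (1 - c.error₂ a N) * Real.log c.M₂ ≤
      n * gaussianCapacity P₂ (a * P₁ + N) + 1 +
        (n * gaussianCapacity P₁ N - (1 - c.error₁ N) * Real.log c.M₁ + 1) := by
  have hM₁ : (0 : ℝ) < c.M₁ := by exact_mod_cast c.M₁_pos
  have hM₂ : (0 : ℝ) < c.M₂ := by exact_mod_cast c.M₂_pos
  have hsa : Real.sqrt a ^ 2 = a := Real.sq_sqrt ha₀
  have hs : a * (P₁ + N) + (1 - a) * N = a * P₁ + N := by ring
  have hs0 : 0 < a * P₁ + N := by positivity
  have hV : 0 < P₁ + N := by positivity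
  have hσ : 0 < P₂ + (a * P₁ + N) := by positivity
  set t : Fin c.M₁ → Fin n → ℝ := fun u => Real.sqrt a • c.enc₁ u with ht
  -- Centring the reference law at the mean interference removes the cross terms with the codewords
  -- of user 2, which need not have mean zero.
  set m : Fin n → ℝ := fun i => (c.M₁ : ℝ)⁻¹ * ∑ u, t u i with hm
  have h1 := log_mul_add_integral_gaussMixLLR_le c.M₁_pos c.enc₁ c.measurable_dec₁ ha₀ ha₁.le hN
    hV (hs ▸ hs0)
  rw [hs, ← one_sub_error₁] at h1
  have h2 := log_mul_le_integral_gaussMixLLR c.M₁_pos c.M₂_pos t c.enc₂ m c.measurable_dec₂ hN hs0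
    hσ
  rw [← one_sub_error₂] at h2
  set E := (c.M₁ : ℝ)⁻¹ * ∑ u, ∑ i, c.enc₁ u i ^ 2 with hE
  have hEle : E ≤ n * P₁ := by
    rw [hE, inv_mul_le_iff₀ hM₁]
    refine (Finset.sum_le_sum fun u _ => c.power₁ u).trans_eq ?_
    simp
  have havg (b : ℝ) : (c.M₁ : ℝ)⁻¹ * ∑ _u : Fin c.M₁, b = b := by simp [hM₁.ne']
  have havg₂ (b : ℝ) : (c.M₂ : ℝ)⁻¹ * ∑ _w : Fin c.M₂, b = b := by simp [hM₂.ne']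
  have hl1 : (c.M₁ : ℝ)⁻¹ * ∑ u, ∫ y, gaussVecLLR (c.enc₁ u) N 0 (P₁ + N) y
      ∂gaussVec (c.enc₁ u) N = n * ((Real.log (P₁ + N) - Real.log N) / 2) - n * N / (2 * N) +
        (n * N + E) / (2 * (P₁ + N)) := by
    simp_rw [integral_gaussVecLLR _ _ _ hN.le]
    rw [inv_mul_sum_sub_div_add_div c.M₁_pos, hE]
    simp
  have hmix (w) : ∫ y, gaussVecLLR 0 (a * P₁ + N) (m - c.enc₂ w) (P₂ + (a * P₁ + N)) y
      ∂gaussMix t N ≤ n * ((Real.log (P₂ + (a * P₁ + N)) - Real.log (a * P₁ + N)) / 2) -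
        (n * N + a * E) / (2 * (a * P₁ + N)) +
        (n * N + (a * E + n * P₂)) / (2 * (P₂ + (a * P₁ + N))) := by
    rw [integral_gaussMix fun u => integrable_gaussVecLLR _ _ _ _ _ _]
    simp_rw [integral_gaussVecLLR _ _ _ hN.le]
    rw [inv_mul_sum_sub_div_add_div c.M₁_pos]
    have e1 : (c.M₁ : ℝ)⁻¹ * ∑ u, ∑ i, (t u i - (0 : Fin n → ℝ) i) ^ 2 = a * E := by
      have ht' (u i) : (t u i - (0 : Fin n → ℝ) i) ^ 2 = a * c.enc₁ u i ^ 2 := by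
        simp [ht, mul_pow, hsa]
      simp_rw [ht', ← Finset.mul_sum]
      rw [hE]; ring
    have e2 : (c.M₁ : ℝ)⁻¹ * ∑ u, ∑ i, (t u i - (m - c.enc₂ w) i) ^ 2 ≤ a * E + n * P₂ := by
      rw [← e1]
      have hi (i : Fin n) : (c.M₁ : ℝ)⁻¹ * ∑ u, (t u i - (m - c.enc₂ w) i) ^ 2 =
          (c.M₁ : ℝ)⁻¹ * ∑ u, t u i ^ 2 - m i ^ 2 + c.enc₂ w i ^ 2 := by
        have hsq (u) : (t u i - (m - c.enc₂ w) i) ^ 2 =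
            t u i ^ 2 - 2 * (m i - c.enc₂ w i) * t u i + (m i - c.enc₂ w i) ^ 2 := by
          rw [Pi.sub_apply]; ring
        simp_rw [hsq]
        rw [Finset.sum_add_distrib, Finset.sum_sub_distrib, mul_add, mul_sub, havg,
          ← Finset.mul_sum, mul_left_comm]
        change _ - _ * m i + _ = _
        ring
      rw [Finset.sum_comm, Finset.mul_sum]
      simp_rw [hi]
      rw [Finset.sum_add_distrib, Finset.sum_sub_distrib, ← Finset.mul_sum, Finset.sum_comm]
      have hm0 : 0 ≤ ∑ i, m i ^ 2 := Finset.sum_nonneg fun i _ => sq_nonneg _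
      have := c.power₂ w
      simp only [Pi.zero_apply, sub_zero]
      linarith
    rw [e1]
    gcongr
  have hl2 : (c.M₂ : ℝ)⁻¹ * ∑ w, ∫ y, gaussVecLLR 0 (a * P₁ + N) (m - c.enc₂ w)
      (P₂ + (a * P₁ + N)) y ∂gaussMix t N ≤
        n * ((Real.log (P₂ + (a * P₁ + N)) - Real.log (a * P₁ + N)) / 2) -
        (n * N + a * E) / (2 * (a * P₁ + N)) +
        (n * N + (a * E + n * P₂)) / (2 * (P₂ + (a * P₁ + N))) := by
    refine le_trans ?_ (havg₂ _).le
    gcongr with w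
    exact hmix w
  rw [hl1] at h1
  rw [gaussianCapacity_eq hP₂ hs0, gaussianCapacity_eq hP₁ hN]
  -- The average power that user 1 leaves unused.
  set η := n * P₁ - E with hη
  have hη0 : 0 ≤ η := by linarith
  have q1 : n * N / (2 * N) = (n : ℝ) / 2 := by field_simp
  have q2 : (n * N + E) / (2 * (P₁ + N)) = n / 2 - η / (2 * (P₁ + N)) := by
    rw [hη]; field_simp; ring
  have q3 : (n * N + a * E) / (2 * (a * P₁ + N)) = n / 2 - a * η / (2 * (a * P₁ + N)) := by
    rw [hη]; field_simp; ring
  have q4 : (n * N + (a * E + n * P₂)) / (2 * (P₂ + (a * P₁ + N))) ≤ n / 2 := by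
    rw [div_le_div_iff₀ (by positivity) (by positivity)]
    nlinarith
  -- Unused power gains user 2 no more than it costs user 1, because `a * N ≤ N`.
  have q5 : a * η / (2 * (a * P₁ + N)) ≤ η / (2 * (P₁ + N)) := by
    rw [div_le_div_iff₀ (by positivity) (by positivity)]
    nlinarith [mul_nonneg hη0 hN.le]
  linarith

end InterferenceCode

/-! ### Achievability: random coding at a fixed block length. -/

section RandomCoding

variable {n M : ℕ}

theorem measurable_gaussVecLLR_uncurry {Ω : Type*} [MeasurableSpace Ω] {f g : Ω → Fin n → ℝ}
    (hf : Measurable f) (hg : Measurable g) (v : ℝ) (x' : Fin n → ℝ) (v' : ℝ) :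
    Measurable fun ω => gaussVecLLR (f ω) v x' v' (g ω) := by
  unfold gaussVecLLR gaussianLLR
  fun_prop

/-- Markov's inequality for the density, which has mean one under the reference law. It bounds the
chance that a codeword unrelated to the output passes the threshold. -/
theorem gaussVec_lt_gaussVecLLR_le {v v' : ℝ} (hv : 0 < v) (hv' : 0 < v') (x x' : Fin n → ℝ)
    (τ : ℝ) :
    gaussVec x' v' {y | τ < gaussVecLLR x v x' v' y} ≤ ENNReal.ofReal (Real.exp (-τ)) := by
  have h1 : ∫⁻ y, ENNReal.ofReal (Real.exp (gaussVecLLR x v x' v' y)) ∂gaussVec x' v' = 1 := by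
    rw [← setLIntegral_univ, ← withDensity_apply _ .univ, ← gaussVec_eq_withDensity hv hv',
      measure_univ]
  have hτ : ENNReal.ofReal (Real.exp (-τ)) * ENNReal.ofReal (Real.exp τ) = 1 := by
    rw [← ENNReal.ofReal_mul (Real.exp_pos _).le, ← Real.exp_add]; simp
  have h2 := mul_meas_ge_le_lintegral (μ := gaussVec x' v')
    (measurable_gaussVecLLR x v x' v').exp.ennreal_ofReal (ENNReal.ofReal (Real.exp τ))
  rw [h1] at h2
  have h3 : {y | τ < gaussVecLLR x v x' v' y} ⊆ {y | ENNReal.ofReal (Real.exp τ) ≤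
      ENNReal.ofReal (Real.exp (gaussVecLLR x v x' v' y))} := fun y hy =>
    ENNReal.ofReal_le_ofReal (Real.exp_le_exp.2 (le_of_lt hy))
  calc _ ≤ gaussVec x' v' {y | ENNReal.ofReal (Real.exp τ) ≤
          ENNReal.ofReal (Real.exp (gaussVecLLR x v x' v' y))} := measure_mono h3
    _ = ENNReal.ofReal (Real.exp (-τ)) * (ENNReal.ofReal (Real.exp τ) * _) := by
      rw [← mul_assoc, hτ, one_mul]
    _ ≤ _ := by
      conv_rhs => rw [← mul_one (ENNReal.ofReal (Real.exp (-τ)))]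
      gcongr

/-- The law of a random codebook with `M` Gaussian codewords of variance `v` per coordinate. -/
noncomputable def codebookLaw (n M : ℕ) (v : ℝ) : Measure (Fin M → Fin n → ℝ) :=
  Measure.pi fun _ => gaussVec 0 v

instance (v : ℝ) : IsProbabilityMeasure (codebookLaw n M v) := by
  unfold codebookLaw; infer_instance

theorem measurePreserving_codebook_eval (v : ℝ) (w : Fin M) :
    MeasurePreserving (fun C : Fin M → Fin n → ℝ => C w) (codebookLaw n M v) (gaussVec 0 v) :=
  measurePreserving_eval (fun _ : Fin M => gaussVec (0 : Fin n → ℝ) v) w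

theorem measurePreserving_codebook_pair (v : ℝ) {w w' : Fin M} (h : w' ≠ w) :
    MeasurePreserving (fun C : Fin M → Fin n → ℝ => (C w', C w)) (codebookLaw n M v)
      ((gaussVec 0 v).prod (gaussVec 0 v)) := by
  have hi : iIndepFun (fun w (C : Fin M → Fin n → ℝ) => C w) (codebookLaw n M v) :=
    iIndepFun_pi (μ := fun _ : Fin M => gaussVec (0 : Fin n → ℝ) v) (X := fun _ x => x)
      fun _ => aemeasurable_id
  refine ⟨by fun_prop, ?_⟩
  rw [(indepFun_iff_map_prod_eq_prod_map_map (measurable_pi_apply w').aemeasurable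
    (measurable_pi_apply w).aemeasurable).1 (hi.indepFun h),
    (measurePreserving_codebook_eval v w').map_eq, (measurePreserving_codebook_eval v w).map_eq]

theorem measurePreserving_add_gaussVec {v V : ℝ} (hv : 0 ≤ v) (hV : 0 ≤ V) (b : ℝ) :
    MeasurePreserving (fun p : (Fin n → ℝ) × (Fin n → ℝ) => b • p.1 + p.2)
      ((gaussVec 0 v).prod (gaussVec 0 V)) (gaussVec 0 (b ^ 2 * v + V)) := by
  refine ⟨by fun_prop, ?_⟩
  simpa using map_prod_gaussVec hv hV (0 : Fin n → ℝ) 0 b 1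

/-- The event that threshold decoding of message `w` fails for the codebook and noise `p`. -/
def decodingFailure (v V τ : ℝ) (w : Fin M) : Set ((Fin M → Fin n → ℝ) × (Fin n → ℝ)) :=
  {p | ¬ τ < gaussVecLLR (p.1 w) V 0 (v + V) (p.1 w + p.2)} ∪
    ⋃ w' ∈ Finset.univ.erase w, {p | τ < gaussVecLLR (p.1 w') V 0 (v + V) (p.1 w + p.2)}

theorem measurableSet_decodingFailure (v V τ : ℝ) (w : Fin M) :
    MeasurableSet (decodingFailure (n := n) v V τ w) := by
  have h (w' : Fin M) : MeasurableSet {p : (Fin M → Fin n → ℝ) × (Fin n → ℝ) |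
      τ < gaussVecLLR (p.1 w') V 0 (v + V) (p.1 w + p.2)} :=
    measurableSet_lt measurable_const
      (measurable_gaussVecLLR_uncurry (by fun_prop) (by fun_prop) _ _ _)
  exact (h w).compl.union (Finset.measurableSet_biUnion _ fun w' _ => h w')

/-- Union bound: the true codeword misses the threshold, or one of `M - 1` others passes it. Each
other codeword is independent of the output, which is Gaussian of variance `v + V`. -/
theorem measure_decodingFailure_le {v V : ℝ} (hv : 0 ≤ v) (hV : 0 < V) (τ : ℝ) (w : Fin M) :
    (codebookLaw n M v).prod (gaussVec 0 V) (decodingFailure v V τ w) ≤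
      (gaussVec 0 v).prod (gaussVec 0 V)
        {p : (Fin n → ℝ) × (Fin n → ℝ) | ¬ τ < gaussVecLLR p.1 V 0 (v + V) (p.1 + p.2)} +
      ENNReal.ofReal ((M - 1) * Real.exp (-τ)) := by
  have hvV : 0 < v + V := by positivity
  have hmeas {f g : (Fin n → ℝ) × (Fin n → ℝ) → Fin n → ℝ} (hf : Measurable f)
      (hg : Measurable g) : MeasurableSet {p | τ < gaussVecLLR (f p) V 0 (v + V) (g p)} :=
    measurableSet_lt measurable_const (measurable_gaussVecLLR_uncurry hf hg _ _ _)
  refine (measure_union_le _ _).trans (add_le_add ?_ ?_)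
  · have hmp := (measurePreserving_codebook_eval (n := n) v w).prod
      (MeasurePreserving.id (gaussVec (0 : Fin n → ℝ) V))
    exact (hmp.measure_preimage
      (hmeas measurable_fst (measurable_fst.add measurable_snd)).compl.nullMeasurableSet).le
  · have hM : 1 ≤ M := w.pos
    have hpair (w' : Fin M) (hw : w' ≠ w) : (codebookLaw n M v).prod (gaussVec 0 V)
        {p | τ < gaussVecLLR (p.1 w') V 0 (v + V) (p.1 w + p.2)} ≤
          ENNReal.ofReal (Real.exp (-τ)) := by
      have hadd := measurePreserving_add_gaussVec (n := n) hv hV.le 1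
      simp only [one_smul, one_pow, one_mul] at hadd
      have hmp := (((MeasurePreserving.id (gaussVec (0 : Fin n → ℝ) v)).prod hadd).comp
        (measurePreserving_prodAssoc _ _ _)).comp ((measurePreserving_codebook_pair v hw).prod
          (MeasurePreserving.id (gaussVec (0 : Fin n → ℝ) V)))
      have hS : MeasurableSet {p : (Fin n → ℝ) × (Fin n → ℝ) |
          τ < gaussVecLLR p.1 V 0 (v + V) p.2} := hmeas (by fun_prop) (by fun_prop)
      have heq := hmp.measure_preimage hS.nullMeasurableSet
      rw [Measure.prod_apply hS] at heq
      refine heq.trans_le ?_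
      calc _ ≤ ∫⁻ _, ENNReal.ofReal (Real.exp (-τ)) ∂gaussVec (0 : Fin n → ℝ) v :=
            lintegral_mono fun x => gaussVec_lt_gaussVecLLR_le hV hvV x 0 τ
        _ = _ := by simp
    refine (measure_biUnion_finset_le _ _).trans
      ((Finset.sum_le_sum fun w' hw => hpair w' (Finset.ne_of_mem_erase hw)).trans_eq ?_)
    rw [Finset.sum_const, Finset.card_erase_of_mem (Finset.mem_univ w), Finset.card_univ,
      Fintype.card_fin, nsmul_eq_mul, ENNReal.ofReal_mul (by simpa using hM),
      ← Nat.cast_one (R := ℝ), ← Nat.cast_sub hM, ENNReal.ofReal_natCast]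

/-- The sets of outputs for which `w` alone passes the threshold are disjoint and measurable, so a
measurable decoder can be glued from constants on them. -/
theorem exists_thresholdDecoder (hM : 0 < M) (C : Fin M → Fin n → ℝ) (v V τ : ℝ) :
    ∃ d : (Fin n → ℝ) → Fin M, Measurable d ∧
      ∀ w s, (C, s) ∉ decodingFailure v V τ w → d (C w + s) = w := by
  have : Nonempty (Fin M) := ⟨⟨0, hM⟩⟩
  let T (w : Fin M) : Set (Fin n → ℝ) := {y | τ < gaussVecLLR (C w) V 0 (v + V) y}
  have hT (w) : MeasurableSet (T w) :=
    measurableSet_lt measurable_const (measurable_gaussVecLLR _ _ _ _)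
  obtain ⟨d, hd, hdT⟩ := exists_measurable_piecewise
    (fun w => T w ∩ ⋂ w' ∈ Finset.univ.erase w, (T w')ᶜ)
    (fun w => (hT w).inter (Finset.measurableSet_biInter _ fun w' _ => (hT w').compl))
    (fun w _ => w) (fun w => measurable_const) (by
      intro w w' hw y hy
      have := Set.mem_iInter₂.1 hy.1.2 w' (Finset.mem_erase.2 ⟨hw.symm, Finset.mem_univ _⟩)
      exact (this hy.2.1).elim)
  refine ⟨d, hd, fun w s hs => hdT w ⟨?_, ?_⟩⟩
  · by_contra h
    exact hs (Or.inl h)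
  · refine Set.mem_iInter₂.2 fun w' hw' h => hs (Or.inr ?_)
    exact Set.mem_iUnion₂.2 ⟨w', hw', h⟩

/-- The set of vectors that violate the power constraint `P`. -/
def powerViolation (n : ℕ) (P : ℝ) : Set (Fin n → ℝ) := {x | n * P < ∑ i, x i ^ 2}

theorem measurableSet_powerViolation (n : ℕ) (P : ℝ) : MeasurableSet (powerViolation n P) :=
  measurableSet_lt measurable_const (by fun_prop)

open Classical in
theorem exists_clip (n : ℕ) {P : ℝ} (hP : 0 ≤ P) : ∃ f : (Fin n → ℝ) → Fin n → ℝ,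
    (∀ x, ∑ i, f x i ^ 2 ≤ n * P) ∧ ∀ x, x ∉ powerViolation n P → f x = x := by
  refine ⟨fun x => if x ∈ powerViolation n P then 0 else x, fun x => ?_, fun x hx => if_neg hx⟩
  by_cases hx : x ∈ powerViolation n P
  · simp only [if_pos hx]
    simpa using by positivity
  · simp only [if_neg hx]
    exact not_lt.1 hx

/-- Random coding with Gaussian codebooks, decoding with interference treated as noise. -/
theorem exists_interferenceCode {P₁ P₂ a N v₁ v₂ : ℝ} (hP₁ : 0 ≤ P₁) (hP₂ : 0 ≤ P₂) (ha : 0 ≤ a)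
    (hN : 0 < N) (hv₁ : 0 ≤ v₁) (hv₂ : 0 ≤ v₂) {M₁ M₂ : ℕ} (hM₁ : 0 < M₁) (hM₂ : 0 < M₂)
    (τ₁ τ₂ : ℝ) {β : ENNReal} (hβ : β ≠ ⊤)
    (hle : gaussVec 0 v₁ (powerViolation n P₁) + gaussVec 0 v₂ (powerViolation n P₂) +
      ((gaussVec 0 v₁).prod (gaussVec 0 N)
        {p : (Fin n → ℝ) × (Fin n → ℝ) | ¬ τ₁ < gaussVecLLR p.1 N 0 (v₁ + N) (p.1 + p.2)} +
        ENNReal.ofReal ((M₁ - 1) * Real.exp (-τ₁))) +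
      ((gaussVec 0 v₂).prod (gaussVec 0 (a * v₁ + N))
        {p : (Fin n → ℝ) × (Fin n → ℝ) |
          ¬ τ₂ < gaussVecLLR p.1 (a * v₁ + N) 0 (v₂ + (a * v₁ + N)) (p.1 + p.2)} +
        ENNReal.ofReal ((M₂ - 1) * Real.exp (-τ₂))) ≤ β) :
    ∃ c : InterferenceCode P₁ P₂ n, c.M₁ = M₁ ∧ c.M₂ = M₂ ∧
      c.error₁ N ≤ β.toReal ∧ c.error₂ a N ≤ β.toReal := by
  have hV : 0 < a * v₁ + N := by positivity
  let κ := (codebookLaw n M₁ v₁).prod (codebookLaw n M₂ v₂)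
  let γ := gaussVec (0 : Fin n → ℝ) N
  let Ω := ((Fin M₁ → Fin n → ℝ) × (Fin M₂ → Fin n → ℝ)) × (Fin n → ℝ)
  -- Outside this event clipping leaves both codewords unchanged and both decoders succeed, so one
  -- codebook pair serves both error bounds.
  let bad (u : Fin M₁) (w : Fin M₂) : Set Ω :=
    {p | p.1.1 u ∈ powerViolation n P₁} ∪ {p | p.1.2 w ∈ powerViolation n P₂} ∪
      {p | (p.1.1, p.2) ∈ decodingFailure v₁ N τ₁ u} ∪
      {p | (p.1.2, Real.sqrt a • p.1.1 u + p.2) ∈ decodingFailure v₂ (a * v₁ + N) τ₂ w}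
  have hbad (u w) : MeasurableSet (bad u w) := by
    refine (((?_ : MeasurableSet _).union ?_).union ?_).union ?_
    · exact measurableSet_preimage (by fun_prop) (measurableSet_powerViolation n P₁)
    · exact measurableSet_preimage (by fun_prop) (measurableSet_powerViolation n P₂)
    · exact measurableSet_preimage (by fun_prop) (measurableSet_decodingFailure v₁ N τ₁ u)
    · exact measurableSet_preimage (by fun_prop) (measurableSet_decodingFailure v₂ _ τ₂ w)
  have hprob (u w) : κ.prod γ (bad u w) ≤ β := by
    refine le_trans ?_ hle
    refine (measure_union_le _ _).trans (add_le_add ((measure_union_le _ _).trans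
      (add_le_add ((measure_union_le _ _).trans (add_le_add ?_ ?_)) ?_)) ?_)
    · exact (((measurePreserving_codebook_eval v₁ u).comp measurePreserving_fst).comp
        (measurePreserving_fst (μ := κ) (ν := γ))).measure_preimage
        (measurableSet_powerViolation n P₁).nullMeasurableSet |>.le
    · exact (((measurePreserving_codebook_eval v₂ w).comp measurePreserving_snd).comp
        (measurePreserving_fst (μ := κ) (ν := γ))).measure_preimage
        (measurableSet_powerViolation n P₂).nullMeasurableSet |>.le
    · refine le_trans (Eq.le ?_) (measure_decodingFailure_le hv₁ hN τ₁ u)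
      exact ((measurePreserving_fst (μ := codebookLaw n M₁ v₁) (ν := codebookLaw n M₂ v₂)).prod
        (MeasurePreserving.id γ)).measure_preimage
        (measurableSet_decodingFailure v₁ N τ₁ u).nullMeasurableSet
    · refine le_trans (Eq.le ?_) (measure_decodingFailure_le hv₂ hV τ₂ w)
      -- Averaged over the first codebook, interference plus noise is Gaussian of variance `a * v₁ +
      -- N`, and it is independent of the second codebook.
      have hadd := (measurePreserving_add_gaussVec (n := n) hv₁ hN.le (Real.sqrt a)).comp
        ((measurePreserving_codebook_eval v₁ u).prod (MeasurePreserving.id γ))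
      rw [Real.sq_sqrt ha] at hadd
      exact ((((MeasurePreserving.id (codebookLaw n M₂ v₂)).prod hadd).comp
        (measurePreserving_prodAssoc _ _ _)).comp
        ((Measure.measurePreserving_swap (μ := codebookLaw n M₁ v₁)
          (ν := codebookLaw n M₂ v₂)).prod (MeasurePreserving.id γ))).measure_preimage
        (measurableSet_decodingFailure v₂ _ τ₂ w).nullMeasurableSet
  let f (C : (Fin M₁ → Fin n → ℝ) × (Fin M₂ → Fin n → ℝ)) : ENNReal :=
    (M₁ : ENNReal)⁻¹ * ∑ u, (M₂ : ENNReal)⁻¹ * ∑ w, γ {z | (C, z) ∈ bad u w}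
  have hmeas (u w) : Measurable fun C => γ {z | (C, z) ∈ bad u w} :=
    measurable_measure_prodMk_left (hbad u w)
  have havg {M : ℕ} (hM : 0 < M) (b : ENNReal) : (M : ENNReal)⁻¹ * ∑ _u : Fin M, b = b := by
    rw [Finset.sum_const, Finset.card_univ, Fintype.card_fin, nsmul_eq_mul, ← mul_assoc,
      ENNReal.inv_mul_cancel (by exact_mod_cast hM.ne') (by simp), one_mul]
  have hmeas₂ (u) : Measurable fun C => ∑ w, γ {z | (C, z) ∈ bad u w} :=
    Finset.measurable_fun_sum _ fun w _ => hmeas u w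
  have hmeas₁ : Measurable fun C => ∑ u, (M₂ : ENNReal)⁻¹ * ∑ w, γ {z | (C, z) ∈ bad u w} :=
    Finset.measurable_fun_sum _ fun u _ => (hmeas₂ u).const_mul _
  have hf : Measurable f := hmeas₁.const_mul _
  have hfint : ∫⁻ C, f C ∂κ ≤ β := by
    rw [lintegral_const_mul _ hmeas₁, lintegral_finsetSum _ fun u _ => (hmeas₂ u).const_mul _]
    refine le_trans ?_ (havg hM₁ β).le
    gcongr with u
    rw [lintegral_const_mul _ (hmeas₂ u), lintegral_finsetSum _ fun w _ => hmeas u w]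
    refine le_trans ?_ (havg hM₂ β).le
    gcongr with w
    refine le_trans (Eq.le ?_) (hprob u w)
    rw [Measure.prod_apply (hbad u w)]
    rfl
  -- Some pair of codebooks does at least as well as the average.
  obtain ⟨⟨C₁, C₂⟩, hC⟩ := exists_le_lintegral (μ := κ) hf.aemeasurable
  replace hC := hC.trans hfint
  obtain ⟨clip₁, hc₁, hc₁'⟩ := exists_clip n hP₁
  obtain ⟨clip₂, hc₂, hc₂'⟩ := exists_clip n hP₂
  obtain ⟨d₁, hd₁, hd₁'⟩ := exists_thresholdDecoder hM₁ C₁ v₁ N τ₁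
  obtain ⟨d₂, hd₂, hd₂'⟩ := exists_thresholdDecoder hM₂ C₂ v₂ (a * v₁ + N) τ₂
  let c : InterferenceCode P₁ P₂ n :=
    { M₁ := M₁, M₂ := M₂, M₁_pos := hM₁, M₂_pos := hM₂
      enc₁ := fun u => clip₁ (C₁ u), enc₂ := fun w => clip₂ (C₂ w)
      power₁ := fun _ => hc₁ _, power₂ := fun _ => hc₂ _
      dec₁ := d₁, dec₂ := d₂, measurable_dec₁ := hd₁, measurable_dec₂ := hd₂ }
  let E : Set (Fin M₁ × Fin M₂ × (Fin n → ℝ)) := ⋃ u, ⋃ w,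
    {u} ×ˢ ({w} ×ˢ {z | ((C₁, C₂), z) ∈ bad u w})
  have hE : MeasurableSet E := .iUnion fun u => .iUnion fun w =>
    (measurableSet_singleton u).prod ((measurableSet_singleton w).prod
      (measurable_prodMk_left (hbad u w)))
  have hmemE (u w z) : (u, w, z) ∈ E ↔ ((C₁, C₂), z) ∈ bad u w := by
    simp [E]
  have hlaw : c.law N E ≤ β := by
    rw [InterferenceCode.law_apply c N hE]
    refine le_trans (Eq.le ?_) hC
    simp_rw [hmemE]
    rfl
  have hgood {u w z} (h : (u, w, z) ∉ E) :
      d₁ (clip₁ (C₁ u) + z) = u ∧ d₂ (clip₂ (C₂ w) + Real.sqrt a • clip₁ (C₁ u) + z) = w := by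
    rw [hmemE] at h
    simp only [bad, Set.mem_union, not_or] at h
    obtain ⟨⟨⟨h1, h2⟩, h3⟩, h4⟩ := h
    rw [hc₁' _ h1, hc₂' _ h2, add_assoc]
    exact ⟨hd₁' u z h3, hd₂' w _ h4⟩
  have hreal : (c.law N).real E ≤ β.toReal := ENNReal.toReal_mono hβ hlaw
  have hfin : c.law N E ≠ ⊤ := ne_top_of_le_ne_top hβ hlaw
  refine ⟨c, rfl, rfl, (measureReal_mono ?_ hfin).trans hreal,
    (measureReal_mono ?_ hfin).trans hreal⟩
  · rintro ⟨u, w, z⟩ h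
    by_contra hn
    exact h (hgood hn).1
  · rintro ⟨u, w, z⟩ h
    by_contra hn
    exact h (hgood hn).2

end RandomCoding

/-! ### Achievability: choice of parameters and limits. -/

theorem gaussianCapacity_nonneg {P V : ℝ} (hP : 0 ≤ P) (hV : 0 < V) : 0 ≤ gaussianCapacity P V := by
  have : 0 ≤ P / V := by positivity
  exact mul_nonneg (by norm_num) (Real.log_nonneg (by linarith))

theorem gaussianCapacity_anti {P V W : ℝ} (hP : 0 ≤ P) (hV : 0 < V) (hVW : V ≤ W) :
    gaussianCapacity P W ≤ gaussianCapacity P V := by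
  have hW : 0 < W := hV.trans_le hVW
  unfold gaussianCapacity
  gcongr

/-- Continuity of the capacity allows a variance strictly below `P`, which leaves room for power
fluctuations. For `P = 0` there is no room, but the codewords vanish. -/
theorem exists_le_gaussianCapacity {P V δ : ℝ} (hP : 0 ≤ P) (hV : 0 < V) (hδ : 0 < δ) :
    ∃ v, 0 ≤ v ∧ v ≤ P ∧ (v < P ∨ v = 0 ∧ P = 0) ∧
      gaussianCapacity P V - δ ≤ gaussianCapacity v V := by
  rcases hP.eq_or_lt with rfl | hP
  · exact ⟨0, le_rfl, le_rfl, Or.inr ⟨rfl, rfl⟩, by linarith⟩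
  have hc : ContinuousAt (fun v => gaussianCapacity v V) P := by
    unfold gaussianCapacity
    refine continuousAt_const.mul (ContinuousAt.log (by fun_prop) ?_)
    positivity
  have h1 : ∀ᶠ v in 𝓝[<] P, gaussianCapacity P V - δ < gaussianCapacity v V :=
    nhdsWithin_le_nhds (hc.eventually_const_lt (by linarith))
  have h2 : ∀ᶠ v in 𝓝[<] P, 0 < v := nhdsWithin_le_nhds (lt_mem_nhds hP)
  obtain ⟨v, ⟨h1, h2⟩, h3⟩ := ((h1.and h2).and self_mem_nhdsWithin).exists
  exact ⟨v, h2.le, le_of_lt h3, Or.inl h3, h1.le⟩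

theorem exists_gaussVec_powerViolation_le {v P : ℝ} (hv : 0 ≤ v) (hvP : v < P ∨ v = 0 ∧ P = 0) :
    ∃ K : ℝ, 0 ≤ K ∧ ∀ n : ℕ, 0 < n →
      gaussVec (0 : Fin n → ℝ) v (powerViolation n P) ≤ ENNReal.ofReal (K / n) := by
  rcases hvP with h | ⟨rfl, rfl⟩
  · refine ⟨_, div_nonneg (variance_nonneg (fun y => y ^ 2) (gaussianReal 0 v.toNNReal))
      (sq_nonneg (P - v)), fun n hn => ?_⟩
    refine (measure_mono fun x hx => ?_).trans
      (gaussVec_sum_sq_concentration hv (sub_pos.2 h) hn)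
    have hx' : n * P < ∑ i, x i ^ 2 := hx
    rw [Set.mem_ofPred_eq, mul_sub]
    exact (sub_le_sub_right hx'.le _).trans (le_abs_self _)
  · refine ⟨0, le_rfl, fun n _ => ?_⟩
    have h := integral_sum_sq_gaussVec (0 : Fin n → ℝ) 0 le_rfl
    have hi := integrable_sum_sq_gaussVec (0 : Fin n → ℝ) 0 0
    simp only [Pi.zero_apply, sub_zero, mul_zero, ne_eq, OfNat.ofNat_ne_zero, not_false_eq_true,
      zero_pow, Finset.sum_const_zero, add_zero] at h hi
    rw [integral_eq_zero_iff_of_nonneg (fun y => Finset.sum_nonneg fun i _ => sq_nonneg _) hi] at h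
    rw [zero_div, ENNReal.ofReal_zero, nonpos_iff_eq_zero]
    refine measure_mono_null (fun x hx => ?_) h
    have hx' : (n : ℝ) * 0 < ∑ i, x i ^ 2 := hx
    intro h0
    simp only [Pi.zero_apply] at h0
    rw [h0] at hx'
    simp at hx'

/-- The log-density is `n` times the capacity plus a difference of normalised squared norms of
output and noise, each concentrated at `n / 2`. -/
theorem exists_miss_le {v V δ : ℝ} (hv : 0 ≤ v) (hV : 0 < V) (hδ : 0 < δ) :
    ∃ K : ℝ, 0 ≤ K ∧ ∀ n : ℕ, 0 < n → (gaussVec 0 v).prod (gaussVec 0 V)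
      {p : (Fin n → ℝ) × (Fin n → ℝ) |
        ¬ n * (gaussianCapacity v V - δ) < gaussVecLLR p.1 V 0 (v + V) (p.1 + p.2)} ≤
      ENNReal.ofReal (K / n) := by
  have hvV : 0 < v + V := by positivity
  -- A deviation of `n * δ'` moves each quadratic term by at most `n * δ / 4`.
  set δ' := V * δ / 2 with hδ'
  have hδ'0 : 0 < δ' := by positivity
  set K₁ := Var[fun y => y ^ 2; gaussianReal 0 V.toNNReal] / δ' ^ 2
  set K₂ := Var[fun y => y ^ 2; gaussianReal 0 (v + V).toNNReal] / δ' ^ 2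
  have hK₁ : 0 ≤ K₁ := div_nonneg (variance_nonneg _ _) (sq_nonneg _)
  have hK₂ : 0 ≤ K₂ := div_nonneg (variance_nonneg _ _) (sq_nonneg _)
  refine ⟨K₁ + K₂, add_nonneg hK₁ hK₂, fun n hn => ?_⟩
  have hn' : (0 : ℝ) < n := by exact_mod_cast hn
  let B (V : ℝ) : Set (Fin n → ℝ) := {y | n * δ' ≤ |∑ i, y i ^ 2 - n * V|}
  have hB (V) : MeasurableSet (B V) := measurableSet_le measurable_const (by fun_prop)
  have hadd := measurePreserving_add_gaussVec (n := n) hv hV.le 1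
  simp only [one_smul, one_pow, one_mul] at hadd
  have h1 := (measurePreserving_snd (μ := gaussVec (0 : Fin n → ℝ) v)
    (ν := gaussVec 0 V)).measure_preimage (hB V).nullMeasurableSet
  have h2 := hadd.measure_preimage (hB (v + V)).nullMeasurableSet
  calc _ ≤ (gaussVec 0 v).prod (gaussVec 0 V) (Prod.snd ⁻¹' B V ∪
        (fun p : (Fin n → ℝ) × (Fin n → ℝ) => p.1 + p.2) ⁻¹' B (v + V)) := by
        refine measure_mono fun p hp => ?_
        by_contra hn
        simp only [Set.mem_union, Set.mem_preimage, not_or, B, Set.mem_ofPred_eq, not_le] at hn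
        refine hp ?_
        rw [gaussianCapacity_eq hv hV, gaussVecLLR_eq]
        have e1 := (abs_lt.1 hn.1).2
        have e2 := (abs_lt.1 hn.2).1
        simp only [Pi.add_apply, add_sub_cancel_left, Pi.zero_apply, sub_zero] at e2 ⊢
        have f1 : (∑ i, p.2 i ^ 2) / (2 * V) < n / 2 + n * (δ / 4) := by
          rw [div_lt_iff₀ (by positivity)]
          calc _ < n * V + n * δ' := by linarith
            _ = _ := by rw [hδ']; ring
        have f2 : n / 2 - n * (δ / 4) < (∑ i, (p.1 i + p.2 i) ^ 2) / (2 * (v + V)) := by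
          rw [lt_div_iff₀ (by positivity)]
          have : 0 ≤ n * δ * v := by positivity
          calc (n / 2 - n * (δ / 4)) * (2 * (v + V)) ≤ n * (v + V) - n * δ' := by rw [hδ']; linarith
            _ < _ := by linarith
        nlinarith [mul_pos hn' hδ]
    _ ≤ gaussVec 0 V (B V) + gaussVec 0 (v + V) (B (v + V)) :=
        (measure_union_le _ _).trans_eq (by rw [h1, h2])
    _ ≤ ENNReal.ofReal (K₁ / n) + ENNReal.ofReal (K₂ / n) :=
        add_le_add (gaussVec_sum_sq_concentration hV.le hδ'0 hn)
          (gaussVec_sum_sq_concentration hvV.le hδ'0 hn)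
    _ = _ := by rw [← ENNReal.ofReal_add (by positivity) (by positivity), add_div]

theorem abs_log_ceil_exp_div_sub_le {C δ : ℝ} (hC : 0 ≤ C) (hδ : 0 ≤ δ) {n : ℕ} (hn : 0 < n)
    (h2 : Real.log 2 / n ≤ δ) :
    |Real.log (⌈Real.exp (n * (C - δ))⌉₊ : ℝ) / n - C| ≤ δ := by
  have hn' : (0 : ℝ) < n := by exact_mod_cast hn
  have hle := Nat.le_ceil (Real.exp (n * (C - δ)))
  have hlt := Nat.ceil_lt_add_one (Real.exp_pos (n * (C - δ))).le
  have hpos : (0 : ℝ) < (⌈Real.exp (n * (C - δ))⌉₊ : ℝ) := (Real.exp_pos _).trans_le hle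
  rw [abs_le]
  constructor
  · have : C - δ ≤ Real.log (⌈Real.exp (n * (C - δ))⌉₊ : ℝ) / n := by
      rw [le_div_iff₀ hn', Real.le_log_iff_exp_le hpos, mul_comm]
      exact hle
    linarith
  · have : Real.log (⌈Real.exp (n * (C - δ))⌉₊ : ℝ) / n ≤ C + Real.log 2 / n := by
      rw [div_le_iff₀ hn', add_mul, div_mul_cancel₀ _ hn'.ne', Real.log_le_iff_le_exp hpos,
        Real.exp_add, Real.exp_log two_pos]
      have e1 : Real.exp (n * (C - δ)) ≤ Real.exp (C * n) :=
        Real.exp_le_exp.2 (by nlinarith)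
      have e2 : 1 ≤ Real.exp (C * n) := Real.one_le_exp (by positivity)
      linarith
    linarith

theorem eventually_exists_interferenceCode {a N P₁ P₂ : ℝ} (ha : 0 ≤ a) (hN : 0 < N)
    (hP₁ : 0 ≤ P₁) (hP₂ : 0 ≤ P₂) {δ : ℝ} (hδ : 0 < δ) :
    ∀ᶠ n : ℕ in atTop, ∃ c : InterferenceCode P₁ P₂ n,
      |c.rate₁ - gaussianCapacity P₁ N| ≤ δ ∧
      |c.rate₂ - gaussianCapacity P₂ (a * P₁ + N)| ≤ δ ∧ c.error₁ N ≤ δ ∧ c.error₂ a N ≤ δ := by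
  have hS : 0 < a * P₁ + N := by positivity
  set C₁ := gaussianCapacity P₁ N with hC₁
  set C₂ := gaussianCapacity P₂ (a * P₁ + N) with hC₂
  obtain ⟨v₁, hv₁, hvP₁, hv₁', hcap₁⟩ := exists_le_gaussianCapacity hP₁ hN (half_pos (half_pos hδ))
  obtain ⟨v₂, hv₂, -, hv₂', hcap₂⟩ := exists_le_gaussianCapacity hP₂ hS (half_pos (half_pos hδ))
  have hV : 0 < a * v₁ + N := by positivity
  -- The reduced power of user 1 only lowers the interference at receiver 2.
  replace hcap₂ := hcap₂.trans (gaussianCapacity_anti hv₂ hV (W := a * P₁ + N) (by gcongr))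
  rw [← hC₁] at hcap₁
  rw [← hC₂] at hcap₂
  have hδ8 : 0 < δ / 8 := by positivity
  obtain ⟨K₁, hK₁, hp₁⟩ := exists_gaussVec_powerViolation_le hv₁ hv₁'
  obtain ⟨K₂, hK₂, hp₂⟩ := exists_gaussVec_powerViolation_le hv₂ hv₂'
  obtain ⟨K₃, hK₃, hm₁⟩ := exists_miss_le hv₁ hN hδ8
  obtain ⟨K₄, hK₄, hm₂⟩ := exists_miss_le hv₂ hV hδ8
  have hlim : Tendsto (fun n : ℕ => (K₁ + K₂ + K₃ + K₄) / n + 2 * Real.exp (-(δ / 8)) ^ n) atTop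
      (𝓝 0) := by
    have h := (tendsto_const_div_atTop_nhds_zero_nat (K₁ + K₂ + K₃ + K₄)).add
      ((tendsto_pow_atTop_nhds_zero_of_lt_one (Real.exp_pos (-(δ / 8))).le
        (by simpa using hδ)).const_mul 2)
    simpa using h
  have hlog := tendsto_const_div_atTop_nhds_zero_nat (Real.log 2)
  filter_upwards [hlim.eventually_le_const hδ, hlog.eventually_le_const (half_pos hδ),
    eventually_gt_atTop 0] with n hβ hlog2 hn
  have hn' : (0 : ℝ) < n := by exact_mod_cast hn
  -- Budget per channel use: reduced power costs `δ / 4` and the threshold a further `δ / 8`, while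
  -- the target rate is lowered by `δ / 2`. The exponent `-δ / 8` is left for wrong codewords.
  have hM {C τ : ℝ} (hτ : n * (C - 3 * δ / 8) ≤ τ) :
      ENNReal.ofReal (((⌈Real.exp (n * (C - δ / 2))⌉₊ : ℝ) - 1) * Real.exp (-τ)) ≤
        ENNReal.ofReal (Real.exp (-(δ / 8)) ^ n) := by
    refine ENNReal.ofReal_le_ofReal ?_
    have hlt := Nat.ceil_lt_add_one (Real.exp_pos (n * (C - δ / 2))).le
    calc _ ≤ Real.exp (n * (C - δ / 2)) * Real.exp (-τ) := by gcongr; linarith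
      _ ≤ _ := by
        rw [← Real.exp_add, ← Real.exp_nat_mul]
        exact Real.exp_le_exp.2 (by linarith)
  obtain ⟨c, hc₁, hc₂, he₁, he₂⟩ := exists_interferenceCode (n := n) hP₁ hP₂ ha hN hv₁ hv₂
    (M₁ := ⌈Real.exp (n * (C₁ - δ / 2))⌉₊) (M₂ := ⌈Real.exp (n * (C₂ - δ / 2))⌉₊)
    (Nat.ceil_pos.2 (Real.exp_pos _)) (Nat.ceil_pos.2 (Real.exp_pos _))
    (n * (gaussianCapacity v₁ N - δ / 8)) (n * (gaussianCapacity v₂ (a * v₁ + N) - δ / 8))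
    (β := ENNReal.ofReal ((K₁ + K₂ + K₃ + K₄) / n + 2 * Real.exp (-(δ / 8)) ^ n))
    ENNReal.ofReal_ne_top (by
      calc _ ≤ ENNReal.ofReal (K₁ / n) + ENNReal.ofReal (K₂ / n) +
            (ENNReal.ofReal (K₃ / n) + ENNReal.ofReal (Real.exp (-(δ / 8)) ^ n)) +
            (ENNReal.ofReal (K₄ / n) + ENNReal.ofReal (Real.exp (-(δ / 8)) ^ n)) :=
          add_le_add (add_le_add (add_le_add (hp₁ n hn) (hp₂ n hn))
            (add_le_add (hm₁ n hn) (hM (mul_le_mul_of_nonneg_left (by linarith) hn'.le))))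
            (add_le_add (hm₂ n hn) (hM (mul_le_mul_of_nonneg_left (by linarith) hn'.le)))
        _ = _ := by
          rw [← ENNReal.ofReal_add (by positivity) (by positivity),
            ← ENNReal.ofReal_add (by positivity) (by positivity),
            ← ENNReal.ofReal_add (by positivity) (by positivity),
            ← ENNReal.ofReal_add (by positivity) (by positivity),
            ← ENNReal.ofReal_add (by positivity) (by positivity)]
          congr 1; ring)
  rw [ENNReal.toReal_ofReal (by positivity)] at he₁ he₂
  have hr₁ := abs_log_ceil_exp_div_sub_le (gaussianCapacity_nonneg hP₁ hN) (half_pos hδ).le hn hlog2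
  have hr₂ := abs_log_ceil_exp_div_sub_le (gaussianCapacity_nonneg hP₂ hS) (half_pos hδ).le hn hlog2
  refine ⟨c, ?_, ?_, he₁.trans hβ, he₂.trans hβ⟩
  · rw [InterferenceCode.rate₁, hc₁]
    exact hr₁.trans (by linarith)
  · rw [InterferenceCode.rate₂, hc₂]
    exact hr₂.trans (by linarith)

/-- Choosing near-minimisers of `g n` replaces a diagonal argument over `δ`. -/
theorem exists_tendsto_zero_of_eventually_le {α : ℕ → Type*} [∀ n, Nonempty (α n)]
    (g : ∀ n, α n → ℝ) (hg : ∀ n x, 0 ≤ g n x) (h : ∀ δ > 0, ∀ᶠ n in atTop, ∃ x, g n x ≤ δ) :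
    ∃ c : ∀ n, α n, Tendsto (fun n => g n (c n)) atTop (𝓝 0) := by
  have hbdd (n) : BddBelow (Set.range (g n)) := ⟨0, by rintro _ ⟨x, rfl⟩; exact hg n x⟩
  have hex (n : ℕ) : ∃ x, g n x < (⨅ x, g n x) + 1 / ((n : ℝ) + 1) :=
    exists_lt_of_ciInf_lt (lt_add_of_pos_right _ Nat.one_div_pos_of_nat)
  choose c hc using hex
  refine ⟨c, Metric.tendsto_atTop'.2 fun δ hδ => ?_⟩
  have h1 := (tendsto_one_div_add_atTop_nhds_zero_nat (𝕜 := ℝ)).eventually_lt_const (half_pos hδ)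
  obtain ⟨n₀, hn₀⟩ := eventually_atTop.1 ((h (δ / 2) (half_pos hδ)).and h1)
  refine ⟨n₀, fun n hn => ?_⟩
  obtain ⟨⟨x, hx⟩, hn1⟩ := hn₀ n (le_of_lt hn)
  rw [Real.dist_eq, sub_zero, abs_of_nonneg (hg n _)]
  linarith [hc n, ciInf_le (hbdd n) x]

theorem InterferenceCode.nonempty {P₁ P₂ : ℝ} (hP₁ : 0 ≤ P₁) (hP₂ : 0 ≤ P₂) (n : ℕ) :
    Nonempty (InterferenceCode P₁ P₂ n) :=
  ⟨{ M₁ := 1, M₂ := 1, M₁_pos := one_pos, M₂_pos := one_pos, enc₁ := 0, enc₂ := 0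
     power₁ := fun _ => by simpa using by positivity
     power₂ := fun _ => by simpa using by positivity
     dec₁ := 0, dec₂ := 0, measurable_dec₁ := measurable_const
     measurable_dec₂ := measurable_const }⟩

theorem exists_isReliable_tendsto {a N P₁ P₂ : ℝ} (ha : 0 ≤ a) (hN : 0 < N) (hP₁ : 0 ≤ P₁)
    (hP₂ : 0 ≤ P₂) : ∃ c : ∀ n, InterferenceCode P₁ P₂ n, IsReliable a N c ∧
      Tendsto (fun n => (c n).rate₁) atTop (𝓝 (gaussianCapacity P₁ N)) ∧
      Tendsto (fun n => (c n).rate₂) atTop (𝓝 (gaussianCapacity P₂ (a * P₁ + N))) := by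
  have := InterferenceCode.nonempty hP₁ hP₂
  have he₁ (n) (c : InterferenceCode P₁ P₂ n) : 0 ≤ c.error₁ N := measureReal_nonneg
  have he₂ (n) (c : InterferenceCode P₁ P₂ n) : 0 ≤ c.error₂ a N := measureReal_nonneg
  obtain ⟨c, hc⟩ := exists_tendsto_zero_of_eventually_le
    (fun n (c : InterferenceCode P₁ P₂ n) => |c.rate₁ - gaussianCapacity P₁ N| +
      |c.rate₂ - gaussianCapacity P₂ (a * P₁ + N)| + c.error₁ N + c.error₂ a N)
    (fun n c => by have := he₁ n c; have := he₂ n c; positivity) (fun δ hδ => by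
      filter_upwards [eventually_exists_interferenceCode ha hN hP₁ hP₂
        (show 0 < δ / 4 by positivity)] with n ⟨c, h1, h2, h3, h4⟩
      exact ⟨c, by linarith⟩)
  refine ⟨c, ⟨?_, ?_⟩, ?_, ?_⟩
  · refine squeeze_zero (fun n => he₁ n _) (fun n => ?_) hc
    linarith [he₂ n (c n), abs_nonneg ((c n).rate₁ - gaussianCapacity P₁ N),
      abs_nonneg ((c n).rate₂ - gaussianCapacity P₂ (a * P₁ + N))]
  · refine squeeze_zero (fun n => he₂ n _) (fun n => ?_) hc
    linarith [he₁ n (c n), abs_nonneg ((c n).rate₁ - gaussianCapacity P₁ N),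
      abs_nonneg ((c n).rate₂ - gaussianCapacity P₂ (a * P₁ + N))]
  · refine tendsto_iff_dist_tendsto_zero.2 (squeeze_zero (fun n => dist_nonneg) (fun n => ?_) hc)
    rw [Real.dist_eq]
    linarith [he₁ n (c n), he₂ n (c n),
      abs_nonneg ((c n).rate₂ - gaussianCapacity P₂ (a * P₁ + N))]
  · refine tendsto_iff_dist_tendsto_zero.2 (squeeze_zero (fun n => dist_nonneg) (fun n => ?_) hc)
    rw [Real.dist_eq]
    linarith [he₁ n (c n), he₂ n (c n), abs_nonneg ((c n).rate₁ - gaussianCapacity P₁ N)]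

/-! ### Asymptotic comparison and the corner point. -/

theorem almostLE_iff {A B : ℕ → ℝ} :
    AlmostLE A B ↔ ∀ δ > 0, ∀ᶠ n : ℕ in atTop, A n ≤ B n + n * δ := by
  constructor
  · rintro ⟨ε, _, hε, h⟩ δ hδ
    filter_upwards [hε.eventually_le_const hδ, eventually_gt_atTop 0] with n h1 hn
    exact (h n hn).trans (by gcongr)
  · intro h
    have h0 : Tendsto (fun n : ℕ => max 0 ((A n - B n) / n)) atTop (𝓝 0) := by
      refine Metric.tendsto_atTop'.2 fun δ hδ => ?_
      obtain ⟨n₀, hn₀⟩ := eventually_atTop.1 ((h (δ / 2) (half_pos hδ)).and (eventually_gt_atTop 0))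
      refine ⟨n₀, fun n hn => ?_⟩
      obtain ⟨h1, hn⟩ := hn₀ n (le_of_lt hn)
      have hn' : (0 : ℝ) < n := by exact_mod_cast hn
      rw [Real.dist_eq, sub_zero, abs_of_nonneg (le_max_left _ _)]
      refine (max_le (half_pos hδ).le ?_).trans_lt (half_lt_self hδ)
      rw [div_le_iff₀ hn']
      linarith
    -- The normalised excess, with `1 / (n + 1)` added to make it strictly positive.
    refine ⟨fun n => max 0 ((A n - B n) / n) + 1 / ((n : ℝ) + 1), fun n => ?_, ?_, fun n hn => ?_⟩
    · exact add_pos_of_nonneg_of_pos (le_max_left _ _) Nat.one_div_pos_of_nat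
    · simpa using h0.add (tendsto_one_div_add_atTop_nhds_zero_nat (𝕜 := ℝ))
    · have hn' : (0 : ℝ) < n := by exact_mod_cast hn
      have h1 : (A n - B n) / n ≤ max 0 ((A n - B n) / n) + 1 / ((n : ℝ) + 1) :=
        (le_max_right _ _).trans (le_add_of_nonneg_right Nat.one_div_pos_of_nat.le)
      rw [div_le_iff₀ hn'] at h1
      linarith

theorem almostLE_of_isReliable {a N P₁ P₂ : ℝ} (ha₀ : 0 ≤ a) (ha₁ : a < 1) (hN : 0 < N)
    (hP₁ : 0 ≤ P₁) (hP₂ : 0 ≤ P₂) {c : ∀ n, InterferenceCode P₁ P₂ n} (hc : IsReliable a N c)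
    (h : AlmostLE (fun n => n * gaussianCapacity P₁ N) (fun n => n * (c n).rate₁)) :
    AlmostLE (fun n => n * (c n).rate₂)
      (fun n => n * gaussianCapacity P₂ (a * P₁ + N)) := by
  rw [almostLE_iff] at h ⊢
  intro δ hδ
  set C₁ := gaussianCapacity P₁ N
  set C₂ := gaussianCapacity P₂ (a * P₁ + N)
  -- The finite-length bound solved for `R₂`, with `R₁` replaced by `C₁ - δ / 2`; its limit is `C₂ +
  -- δ / 2`.
  have hlim : Tendsto (fun n : ℕ =>
      (C₂ + C₁ - (1 - (c n).error₁ N) * (C₁ - δ / 2) + 2 / n) / (1 - (c n).error₂ a N)) atTop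
      (𝓝 ((C₂ + C₁ - (1 - 0) * (C₁ - δ / 2) + 0) / (1 - 0))) :=
    ((tendsto_const_nhds.sub ((tendsto_const_nhds.sub hc.1).mul_const _)).add
      (tendsto_const_div_atTop_nhds_zero_nat 2)).div (tendsto_const_nhds.sub hc.2) (by norm_num)
  filter_upwards [h (δ / 2) (half_pos hδ), hlim.eventually_le_const (u := C₂ + δ) (by linarith),
    hc.1.eventually_le_const one_pos, hc.2.eventually_lt_const one_pos, eventually_gt_atTop 0]
    with n h1 h2 h3 h4 hn
  have hn' : (0 : ℝ) < n := by exact_mod_cast hn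
  have hb := (c n).one_sub_error₂_mul_log_le ha₀ ha₁ hN hP₁ hP₂
  have hr₁ : Real.log (c n).M₁ = n * (c n).rate₁ := by
    rw [InterferenceCode.rate₁, mul_div_cancel₀ _ hn'.ne']
  have hr₂ : Real.log (c n).M₂ = n * (c n).rate₂ := by
    rw [InterferenceCode.rate₂, mul_div_cancel₀ _ hn'.ne']
  rw [hr₁, hr₂] at hb
  have h5 : (1 - (c n).error₁ N) * (n * (C₁ - δ / 2)) ≤
      (1 - (c n).error₁ N) * (n * (c n).rate₁) :=
    mul_le_mul_of_nonneg_left (by linarith) (by linarith)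
  rw [div_le_iff₀ (by linarith)] at h2
  have h6 := mul_le_mul_of_nonneg_left h2 hn'.le
  have h7 : n * (2 / (n : ℝ)) = 2 := by field_simp
  have h8 : (1 - (c n).error₂ a N) * (n * (c n).rate₂) ≤
      (1 - (c n).error₂ a N) * (n * (C₂ + δ)) := by
    calc _ ≤ _ := hb
      _ ≤ n * (C₂ + C₁ - (1 - (c n).error₁ N) * (C₁ - δ / 2) + 2 / n) := by
        rw [mul_add _ _ (2 / (n : ℝ)), h7]
        linarith
      _ ≤ _ := h6
      _ = _ := by ring
  have h9 := le_of_mul_le_mul_left h8 (by linarith)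
  linarith

theorem isFirstCornerPoint_gaussianCapacity {a N P₁ P₂ : ℝ} (ha₀ : 0 ≤ a) (ha₁ : a < 1) (hN : 0 < N)
    (hP₁ : 0 ≤ P₁) (hP₂ : 0 ≤ P₂) : IsFirstCornerPoint a N P₁ P₂
      (gaussianCapacity P₁ N, gaussianCapacity P₂ (a * P₁ + N)) := by
  obtain ⟨c, hc, h1, h2⟩ := exists_isReliable_tendsto ha₀ hN hP₁ hP₂
  exact ⟨rfl, ⟨c, hc, (h1.prodMk_nhds h2).mapClusterPt⟩,
    fun c hc h => almostLE_of_isReliable ha₀ ha₁ hN hP₁ hP₂ hc h⟩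

theorem almostLE_of_tendsto {r : ℕ → ℝ} {C : ℝ} (h : Tendsto r atTop (𝓝 C)) :
    AlmostLE (fun n => n * C) (fun n => n * r n) := by
  refine almostLE_iff.2 fun δ hδ => ?_
  filter_upwards [h.eventually_const_le (show C - δ < C by linarith)] with n hn
  rw [← mul_add]
  gcongr
  linarith

theorem eventually_le_add_of_almostLE {r : ℕ → ℝ} {C : ℝ}
    (h : AlmostLE (fun n => n * r n) (fun n => n * C)) {δ : ℝ} (hδ : 0 < δ) :
    ∀ᶠ n in atTop, r n ≤ C + δ := by
  filter_upwards [almostLE_iff.1 h δ hδ, eventually_gt_atTop 0] with n h1 hn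
  rw [← mul_add] at h1
  exact le_of_mul_le_mul_left h1 (by exact_mod_cast hn)

open Classical in
/-- A point of the capacity region with first coordinate `C` satisfies every asymptotic upper
bound on `R₂` that holds for all reliable sequences with `R₁` almost above `C`, as soon as `C` is
the limit of the rates `R₁` of some reliable sequence. -/
theorem le_of_mem_capacityRegion {a N P₁ P₂ C C₂ C₂' : ℝ}
    (hmem : (C, C₂') ∈ capacityRegion a N P₁ P₂) {c : ∀ n, InterferenceCode P₁ P₂ n}
    (hc : IsReliable a N c) (hC : Tendsto (fun n => (c n).rate₁) atTop (𝓝 C))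
    (hub : ∀ c : ∀ n, InterferenceCode P₁ P₂ n, IsReliable a N c →
      AlmostLE (fun n => n * C) (fun n => n * (c n).rate₁) →
      AlmostLE (fun n => n * (c n).rate₂) (fun n => n * C₂)) : C₂' ≤ C₂ := by
  obtain ⟨c', hc', hclus⟩ := hmem
  obtain ⟨ψ, hψ, hlim⟩ := hclus.tendsto_subseq
  have hl₁ : Tendsto (fun k => (c' (ψ k)).rate₁) atTop (𝓝 C) := hlim.fst_nhds
  have hl₂ : Tendsto (fun k => (c' (ψ k)).rate₂) atTop (𝓝 C₂') := hlim.snd_nhds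
  -- Splicing: the rates `R₁` now converge along all block lengths, while the subsequence still
  -- carries `C₂'`.
  let d (n : ℕ) : InterferenceCode P₁ P₂ n := if n ∈ Set.range ψ then c' n else c n
  have hd : IsReliable a N d := by
    constructor
    · refine (Tendsto.if' (p := fun n => n ∈ Set.range ψ) hc'.1 hc.1).congr fun n => ?_
      split_ifs with hn <;> simp only [d, hn, if_true, if_false]
    · refine (Tendsto.if' (p := fun n => n ∈ Set.range ψ) hc'.2 hc.2).congr fun n => ?_
      split_ifs with hn <;> simp only [d, hn, if_true, if_false]
  have hd₁ : Tendsto (fun n => (d n).rate₁) atTop (𝓝 C) := by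
    refine tendsto_def.2 fun s hs => ?_
    obtain ⟨k₀, hk₀⟩ := eventually_atTop.1 (hl₁ hs)
    filter_upwards [hC hs, eventually_ge_atTop (ψ k₀)] with n h1 h2
    by_cases hn : n ∈ Set.range ψ
    · obtain ⟨k, rfl⟩ := hn
      simp only [Set.mem_preimage, d, if_pos (Set.mem_range_self k)]
      exact hk₀ k (hψ.le_iff_le.1 h2)
    · simp only [Set.mem_preimage, d, if_neg hn]
      exact h1
  have hle := hub d hd (almostLE_of_tendsto hd₁)
  refine le_of_forall_pos_le_add fun δ hδ => le_of_tendsto hl₂ ?_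
  filter_upwards [hψ.tendsto_atTop.eventually (eventually_le_add_of_almostLE hle hδ)] with k hk
  simpa only [d, if_pos (Set.mem_range_self k)] using hk

theorem proposition2 (a N P₁ P₂ : ℝ) (ha₀ : 0 ≤ a) (ha₁ : a < 1) (hN : 0 < N)
    (hP₁ : 0 ≤ P₁) (hP₂ : 0 ≤ P₂) (C₂' : ℝ) :
    IsFirstCornerPoint a N P₁ P₂ (gaussianCapacity P₁ N, C₂') ↔
      C₂' = 1 / 2 * Real.log (1 + P₂ / (a * P₁ + N)) := by
  change _ ↔ C₂' = gaussianCapacity P₂ (a * P₁ + N)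
  constructor
  · rintro ⟨-, hmem, hub⟩
    obtain ⟨c, hc, h1, h2⟩ := exists_isReliable_tendsto ha₀ hN hP₁ hP₂
    refine le_antisymm (le_of_mem_capacityRegion hmem hc h1
      fun c hc h => almostLE_of_isReliable ha₀ ha₁ hN hP₁ hP₂ hc h) ?_
    exact le_of_forall_pos_le_add fun δ hδ =>
      le_of_tendsto h2 (eventually_le_add_of_almostLE (hub c hc (almostLE_of_tendsto h1)) hδ)
  · rintro rfl
    exact isFirstCornerPoint_gaussianCapacity ha₀ ha₁ hN hP₁ hP₂
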